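/- Let $n\ge 0$ be an integer and let $H$ be a complex Hilbert space. Let $U_{ij}$ ($1\le i\ne j\le n$) be pairwise commuting unitaries on $H$ with $U_{ji}=U_{ij}^*$, and let $V_1,\dots,V_n$ be power partial isometries on $H$ (bounded operators all of whose powers are partial isometries) that are $\mathcal U_n$-twisted, i.e. $$V_i^*V_j=U_{ij}V_jV_i^*,\qquad V_iV_j=U_{ji}V_jV_i,\qquad V_kU_{ij}=U_{ij}V_k\qquad (i\ne j,\ 1\le i,j,k\le n).$$ Assume that the family $\{V_1,\dots,V_n\}$ is irreducible: $H\neq 0$, and the only closed subspaces of $H$ invariant under all $V_i$ and $V_i^*$ are $0$ and $H$. Notation. $S$ is the unilateral shift on $\ell^2(\mathbb Z_+)$ with standard basis $(e_m)_{m\ge0}$; $J_p$ ($p\ge1$) is the truncated shift on $\mathbb C^p$ with standard basis $e_0,\dots,e_{p-1}$, $J_pe_m=e_{m+1}$ for $m<p-1$ and $J_pe_{p-1}=0$. In a Hilbert space tensor product $\bigotimes_{i\in I}K_i\otimes H_u$, where $I$ is finite and each $K_i$ is $\ell^2(\mathbb Z_+)$ or some $\mathbb C^p$, and for a unitary $T$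 on $H_u$, let $D^{(i)}[T]$ be the unitary diagonal operator of the factor $i$ with symbol $T$, $$D^{(i)}[T]\Bigl(\bigotimes_{l\in I} e_{k_l}\otimes\eta\Bigr)=\bigotimes_{l\in I} e_{k_l}\otimes T^{k_i}\eta .$$ For an operator $A$ on $K_i$ let $A^{(i)}$ denote $A$ acting on the factor $i$, tensored with the identity on all other factors. Then there are a decomposition into disjoint (possibly empty) sets $$\{1,\dots,n\}=\Phi_s\cup\Phi_b\cup\bigcup_{p\ge1}\Phi_p\cup\Phi_u ,$$ a Hilbert space $H_u$, pairwise commuting unitaries $\tilde U_{ij}$ ($i\ne j$) on $H_u$ with $\tilde U_{ji}=\tilde U_{ij}^*$, an irreducible family $\{U_j:j\in\Phi_u\}$ of unitary operators on $H_u$ that commute with all $\tilde U_{kl}$ and satisfy $$U_i^*U_j=\tilde U_{ij}U_jU_i^*\qquad(i\ne j,\ i,j\in\Phi_u),$$ and a unitary operator $$W:H\to\bigotimes_{i\in\Phi_s}\ell^2(\mathbb Z_+)\otimes\bigotimes_{i\in\Phi_b}\ell^2(\mathbb Z_+)\otimes\bigotimes_{p\ge1}\bigotimes_{i\in\Phi_p}\mathbb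 C^p\otimes H_u$$ such that $WU_{ij}W^*=1\otimes\tilde U_{ij}$ for $i\ne j$ and $$WV_jW^*=\prod_{i\in\Phi_s,\,i<j}D^{(i)}[\tilde U_{ij}]\cdot S^{(j)}\qquad(j\in\Phi_s),$$ $$WV_jW^*=\prod_{i\in\Phi_s}D^{(i)}[\tilde U_{ij}]\prod_{i\in\Phi_b,\,i<j}D^{(i)}[\tilde U_{ji}]\cdot (S^*)^{(j)}\qquad(j\in\Phi_b),$$ $$WV_jW^*=\prod_{i\in\Phi_s}D^{(i)}[\tilde U_{ij}]\prod_{i\in\Phi_b}D^{(i)}[\tilde U_{ji}]\prod_{i\in\bigcup_q\Phi_q,\,i<j}D^{(i)}[\tilde U_{ij}]\cdot J_p^{(j)}\qquad(j\in\Phi_p,\ p\ge1),$$ $$WV_jW^*=\prod_{i\in\Phi_s}D^{(i)}[\tilde U_{ij}]\prod_{i\in\Phi_b}D^{(i)}[\tilde U_{ji}]\prod_{i\in\bigcup_q\Phi_q}D^{(i)}[\tilde U_{ij}]\cdot(1\otimes U_j)\qquad(j\in\Phi_u).$$ (The diagonal operators $D^{(i)}[\,\cdot\,]$ commute with one another,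 and an empty family of operators is irreducible exactly when the space is one-dimensional.) -/

import Mathlib

universe u

set_option linter.unusedSectionVars false

namespace TwistedPPI

noncomputable section

/-! ### Power partial isometries, twisted families, irreducibility -/

section Families

variable {H : Type*} [NormedAddCommGroup H] [InnerProductSpace ℂ H] [CompleteSpace H]

/-- A bounded operator `V` is a partial isometry: `V V* V = V`. -/
def IsPartialIsometry (V : H →L[ℂ] H) : Prop :=
  V * star V * V = V

/-- All the powers of `V` are partial isometries. -/
def IsPowerPartialIsometry (V : H →L[ℂ] H) : Prop :=
  ∀ m : ℕ, IsPartialIsometry (V ^ m)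

variable {ι : Type*}

/-- A commuting family of unitaries `U i j`, `i ≠ j`, with `U j i = (U i j)*`.
The diagonal entries `U i i` play no role. -/
structure IsTwistSystem (U : ι → ι → unitary (H →L[ℂ] H)) : Prop where
  adjoint_eq : ∀ i j, i ≠ j → U j i = star (U i j)
  commute : ∀ i j k l, i ≠ j → k ≠ l → Commute (U i j) (U k l)

/-- `V` is a family of `U`-twisted power partial isometries. -/
structure IsTwistedFamily (U : ι → ι → unitary (H →L[ℂ] H)) (V : ι → H →L[ℂ] H) : Prop where
  system : IsTwistSystem U
  powerPartialIsometry : ∀ i, IsPowerPartialIsometry (V i)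
  star_mul : ∀ i j, i ≠ j → star (V i) * V j = (U i j : H →L[ℂ] H) * V j * star (V i)
  mul : ∀ i j, i ≠ j → V i * V j = (U j i : H →L[ℂ] H) * V j * V i
  commute : ∀ i j k, i ≠ j → Commute (V k) (U i j : H →L[ℂ] H)

/-- A family of operators is irreducible: the Hilbert space is non-zero and its only closed
subspaces reducing all the operators are `0` and the whole space. -/
def IsIrreducibleFamily (V : ι → H →L[ℂ] H) : Prop :=
  Nontrivial H ∧ ∀ M : Submodule ℂ H, IsClosed (M : Set H) →
    (∀ i, ∀ x ∈ M, V i x ∈ M ∧ star (V i) x ∈ M) → M = ⊥ ∨ M = ⊤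

end Families

/-! ### Two kinds of operators on `ℓ²(K; E)` -/

section Operators

variable {K : Type*} {E : Type*} [NormedAddCommGroup E] [InnerProductSpace ℂ E]

/-- The Hilbert space `ℓ²(K; E)`. -/
abbrev L2 (K : Type*) (E : Type*) [NormedAddCommGroup E] [InnerProductSpace ℂ E] : Type _ :=
  lp (fun _ : K => E) 2

theorem summable_sq (f : L2 K E) : Summable fun k => ‖f k‖ ^ 2 := by
  have h := (lp.memℓp f).summable (by norm_num)
  simpa using h

theorem norm_sq_eq (f : L2 K E) : ‖f‖ ^ 2 = ∑' k, ‖f k‖ ^ 2 := by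
  have h := lp.norm_rpow_eq_tsum (p := 2) (by norm_num) f
  simpa using h

theorem memL2_of_summable {f : K → E} (h : Summable fun k => ‖f k‖ ^ 2) :
    Memℓp (E := fun _ : K => E) f 2 := by
  refine memℓp_gen ?_
  simpa using h

open Classical in
theorem summable_pull {s : Set K} {g : K → K} (hg : Set.InjOn g s) (f : L2 K E) :
    Summable (fun k => ‖if k ∈ s then f (g k) else 0‖ ^ 2) ∧
      ∑' k, ‖if k ∈ s then f (g k) else 0‖ ^ 2 ≤ ∑' k, ‖f k‖ ^ 2 := by
  have hinj : Function.Injective (fun k : s => g k) := hg.injective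
  have h1 : (fun k => ‖if k ∈ s then f (g k) else 0‖ ^ 2)
      = s.indicator (fun k => ‖f (g k)‖ ^ 2) := by
    funext k
    by_cases hk : k ∈ s <;> simp [hk]
  have h2 : Summable (fun k : s => ‖f (g k)‖ ^ 2) := (summable_sq f).comp_injective hinj
  rw [h1]
  refine ⟨summable_subtype_iff_indicator.mp h2, ?_⟩
  rw [← tsum_subtype s (fun k => ‖f (g k)‖ ^ 2)]
  exact h2.tsum_le_tsum_of_inj _ hinj (fun _ _ => by positivity) (fun _ => le_rfl) (summable_sq f)

open Classical in
/-- For `g` injective on `s`, the contraction `f ↦ (k ↦ f (g k) if k ∈ s, and 0 otherwise)`. -/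
def pull (s : Set K) (g : K → K) (hg : Set.InjOn g s) : L2 K E →L[ℂ] L2 K E :=
  LinearMap.mkContinuous
    { toFun := fun f =>
        ⟨fun k => if k ∈ s then f (g k) else 0, memL2_of_summable (summable_pull hg f).1⟩
      map_add' := fun f f' => by
        ext k
        change (if k ∈ s then (f + f') (g k) else 0)
          = (if k ∈ s then f (g k) else 0) + (if k ∈ s then f' (g k) else 0)
        by_cases hk : k ∈ s <;> simp [hk]
      map_smul' := fun c f => by
        ext k
        by_cases hk : k ∈ s <;> simp [hk] }
    1 (fun f => by
      rw [one_mul]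
      refine le_of_sq_le_sq ?_ (norm_nonneg f)
      rw [norm_sq_eq, norm_sq_eq]
      exact (summable_pull hg f).2)

open Classical in
theorem pull_apply (s : Set K) (g : K → K) (hg : Set.InjOn g s) (f : L2 K E) (k : K) :
    pull s g hg f k = if k ∈ s then f (g k) else 0 := rfl

variable [CompleteSpace E]

theorem norm_unitary_apply (T : unitary (E →L[ℂ] E)) (x : E) :
    ‖(T : E →L[ℂ] E) x‖ = ‖x‖ :=
  (ContinuousLinearMap.norm_map_iff_adjoint_comp_self (T : E →L[ℂ] E)).mpr
    (Unitary.star_mul_self_of_mem T.2) x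

/-- The diagonal operator `f ↦ (k ↦ T k (f k))` with unitary entries `T k`. -/
def diag (T : K → unitary (E →L[ℂ] E)) : L2 K E →L[ℂ] L2 K E :=
  LinearMap.mkContinuous
    { toFun := fun f =>
        ⟨fun k => (T k : E →L[ℂ] E) (f k), memL2_of_summable (by
          simpa only [norm_unitary_apply] using summable_sq f)⟩
      map_add' := fun f f' => by
        ext k
        change (T k : E →L[ℂ] E) ((f + f') k) = (T k : E →L[ℂ] E) (f k) + (T k : E →L[ℂ] E) (f' k)
        simp
      map_smul' := fun c f => by
        ext k
        simp }
    1 (fun f => by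
      rw [one_mul]
      refine le_of_sq_le_sq ?_ (norm_nonneg f)
      rw [norm_sq_eq, norm_sq_eq]
      simp [norm_unitary_apply])

theorem diag_apply (T : K → unitary (E →L[ℂ] E)) (f : L2 K E) (k : K) :
    diag T f k = (T k : E →L[ℂ] E) (f k) := rfl

end Operators

/-! ### The tensor factors -/

/-- The possible types of a non-unitary member of an irreducible family. -/
inductive Kind : Type
  | shift
  | backward
  | truncated (p : ℕ+)

namespace Kind

/-- The index set of the standard basis: `ℤ₊` for `ℓ²(ℤ₊)`, and `p` points for `ℂ^p`.
Bases are counted from `0`. -/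
def Idx : Kind → Type
  | shift => ℕ
  | backward => ℕ
  | truncated p => Fin p

/-- The position of a basis vector, counted from `0`. -/
def val : (c : Kind) → c.Idx → ℕ
  | shift, m => m
  | backward, m => m
  | truncated _, m => Fin.val m

/-- The preceding basis index (with `0 ↦ 0`). -/
def pred : (c : Kind) → c.Idx → c.Idx
  | shift, m => Nat.pred m
  | backward, m => Nat.pred m
  | truncated _, m => ⟨Nat.pred (Fin.val m), lt_of_le_of_lt (Nat.pred_le _) (Fin.is_lt m)⟩

theorem val_injective (c : Kind) : Function.Injective c.val := by
  cases c with
  | shift => exact fun _ _ h => h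
  | backward => exact fun _ _ h => h
  | truncated p => exact Fin.val_injective

theorem val_pred (c : Kind) (m : c.Idx) : c.val (c.pred m) = c.val m - 1 := by
  cases c <;> rfl

theorem pred_injOn (c : Kind) : Set.InjOn c.pred {m | c.val m ≠ 0} := by
  intro a ha b hb h
  have h' : c.val (c.pred a) = c.val (c.pred b) := by rw [h]
  rw [val_pred, val_pred] at h'
  simp only [Set.mem_ofPred_eq] at ha hb
  exact c.val_injective (by omega)

/-- The Hilbert space `ℓ²(ℤ₊)` or `ℂ^p`. -/
abbrev Factor (c : Kind) : Type := L2 c.Idx ℂ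

/-- The operator `e_m ↦ e_{m+1}`, with `e_{p-1} ↦ 0` on `ℂ^p`: the unilateral shift `S` on
`ℓ²(ℤ₊)` and the truncated shift `J_p` on `ℂ^p`. In coordinates, `(x_m) ↦ (x_{m-1})` with
`x_{-1} = 0`. -/
def forward (c : Kind) : c.Factor →L[ℂ] c.Factor :=
  pull {m | c.val m ≠ 0} c.pred c.pred_injOn

/-- The operator `S`, `S*` or `J_p`, according to the type. -/
def core (c : Kind) : c.Factor →L[ℂ] c.Factor :=
  match c with
  | shift => forward shift
  | backward => ContinuousLinearMap.adjoint (forward backward)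
  | truncated p => forward (truncated p)

open Classical in
theorem core_eq (c : Kind) :
    c.core = if c = backward then ContinuousLinearMap.adjoint c.forward else c.forward := by
  cases c <;> simp [core]

/-- The order in which the tensor factors are listed: shifts, backward shifts, truncated shifts. -/
def rank : Kind → ℕ
  | shift => 0
  | backward => 1
  | truncated _ => 2

end Kind

/-! ### The model space -/

section Model

variable {ι : Type*} [Fintype ι] [DecidableEq ι] (κ : ι → Kind)
variable (E : Type*) [NormedAddCommGroup E] [InnerProductSpace ℂ E]

/-- The Hilbert space tensor product of the factors `ℓ²(ℤ₊)` or `ℂ^p` of types `κ i`, `i : ι`,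
and of `E`, realised as `ℓ²(∏ i, (κ i).Idx; E)`: the tensor `(⊗ i, x i) ⊗ η` is `elem κ x η`
below. By `inner_elem` and `elem_total`, this is the Hilbert space tensor product. -/
abbrev Model : Type _ := L2 (∀ i, (κ i).Idx) E

variable {E}

theorem summable_elem (x : ∀ i, (κ i).Factor) :
    Summable fun k : ∀ i, (κ i).Idx => ‖∏ i, x i (k i)‖ ^ 2 := by
  classical
  refine summable_of_sum_le (c := ∏ i, ∑' m, ‖x i m‖ ^ 2) (fun _ => by positivity) fun s => ?_
  have hs : s ⊆ Fintype.piFinset fun i => s.image fun k => k i := fun k hk =>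
    Fintype.mem_piFinset.mpr fun i => Finset.mem_image_of_mem _ hk
  calc ∑ k ∈ s, ‖∏ i, x i (k i)‖ ^ 2
      ≤ ∑ k ∈ Fintype.piFinset fun i => s.image fun k => k i, ‖∏ i, x i (k i)‖ ^ 2 :=
        Finset.sum_le_sum_of_subset_of_nonneg hs fun _ _ _ => by positivity
    _ = ∏ i, ∑ m ∈ s.image fun k => k i, ‖x i m‖ ^ 2 := by
        rw [Finset.prod_univ_sum]
        simp [Finset.prod_pow]
    _ ≤ ∏ i, ∑' m, ‖x i m‖ ^ 2 :=
        Finset.prod_le_prod (fun _ _ => by positivity) fun i _ =>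
          (summable_sq (x i)).sum_le_tsum _ fun _ _ => by positivity

/-- The elementary tensor `(⊗ i, x i) ⊗ η`. -/
def elem (x : ∀ i, (κ i).Factor) (η : E) : Model κ E :=
  ⟨fun k => (∏ i, x i (k i)) • η, memL2_of_summable (by
    simpa only [norm_smul, mul_pow] using (summable_elem κ x).mul_right (‖η‖ ^ 2))⟩

theorem elem_apply (x : ∀ i, (κ i).Factor) (η : E) (k : ∀ i, (κ i).Idx) :
    elem κ x η k = (∏ i, x i (k i)) • η := rfl

/-- The inner product of elementary tensors is the product of the inner products. -/
theorem inner_elem (x y : ∀ i, (κ i).Factor) (η ξ : E) :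
    inner ℂ (elem κ x η) (elem κ y ξ) = (∏ i, inner ℂ (x i) (y i)) * inner ℂ η ξ := by
  classical
  have h1 := lp.hasSum_inner (𝕜 := ℂ) (elem κ x η) (elem κ y ξ)
  have hmap : Filter.Tendsto (fun S : ∀ i, Finset (κ i).Idx => Fintype.piFinset S)
      Filter.atTop Filter.atTop := by
    refine Filter.tendsto_atTop_atTop.mpr fun s => ⟨fun i => s.image fun k => k i, fun S hS k hk =>
      Fintype.mem_piFinset.mpr fun i => hS i (Finset.mem_image_of_mem _ hk)⟩
  have h2 := Filter.Tendsto.comp (f := fun S : ∀ i, Finset (κ i).Idx => Fintype.piFinset S) h1 hmap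
  have h3 : Filter.Tendsto (fun S : ∀ i, Finset (κ i).Idx =>
      (∏ i, ∑ m ∈ S i, inner ℂ (x i m) (y i m)) * inner ℂ η ξ) Filter.atTop
      (nhds ((∏ i, inner ℂ (x i) (y i)) * inner ℂ η ξ)) := by
    refine Filter.Tendsto.mul_const _ (tendsto_finsetProd _ fun i _ => ?_)
    have h4 := lp.hasSum_inner (𝕜 := ℂ) (x i) (y i)
    exact Filter.Tendsto.comp (f := fun S : ∀ i, Finset (κ i).Idx => S i) h4
      (Filter.tendsto_atTop_atTop.mpr fun s => ⟨fun j => if h : j = i then h ▸ s else ∅,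
        fun S hS => by simpa using hS i⟩)
  refine tendsto_nhds_unique h2 (h3.congr fun S => ?_)
  rw [Finset.prod_univ_sum, Finset.sum_mul]
  refine Finset.sum_congr rfl fun k _ => ?_
  change _ = inner ℂ ((∏ i, x i (k i)) • η) ((∏ i, y i (k i)) • ξ)
  rw [inner_smul_left, inner_smul_right, map_prod]
  simp only [RCLike.inner_apply, Finset.prod_mul_distrib]
  ring

open Classical in
/-- The basis tensors: `e_k ⊗ η` is the function with value `η` at `k` and `0` elsewhere. -/
theorem elem_single (k : ∀ i, (κ i).Idx) (η : E) :
    elem κ (fun i => lp.single 2 (k i) (1 : ℂ)) η = lp.single 2 k η := by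
  ext l
  rw [elem_apply]
  by_cases h : l = k
  · subst h
    simp
  · obtain ⟨i, hi⟩ := Function.ne_iff.mp h
    rw [Finset.prod_eq_zero (Finset.mem_univ i) (by simp [hi])]
    simp [h]

/-- The elementary tensors span a dense subspace. -/
theorem elem_total :
    (Submodule.span ℂ {f : Model κ E | ∃ x η, f = elem κ x η}).topologicalClosure = ⊤ := by
  classical
  rw [eq_top_iff]
  intro f _
  have h := lp.hasSum_single (by norm_num) f
  refine mem_closure_of_tendsto h (Filter.Eventually.of_forall fun s => ?_)
  refine Submodule.sum_mem _ fun k _ => Submodule.subset_span ⟨_, f k, (elem_single κ k (f k)).symm⟩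

theorem update_pred_injOn (i : ι) :
    Set.InjOn (fun k : ∀ i, (κ i).Idx => Function.update k i ((κ i).pred (k i)))
      {k | (κ i).val (k i) ≠ 0} := by
  intro a ha b hb h
  funext l
  by_cases hl : l = i
  · subst hl
    exact (κ l).pred_injOn ha hb (by simpa using congrFun h l)
  · simpa [hl] using congrFun h l

/-- `forward` on the `i`-th tensor factor. -/
def forwardAt (i : ι) : Model κ E →L[ℂ] Model κ E :=
  pull {k | (κ i).val (k i) ≠ 0} (fun k => Function.update k i ((κ i).pred (k i)))
    (update_pred_injOn κ i)

variable [CompleteSpace E]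

/-- `S`, `S*` or `J_p` on the `i`-th tensor factor and the identity on all the others:
`1 ⊗ … ⊗ 1 ⊗ S ⊗ 1 ⊗ … ⊗ 1 ⊗ 1_E`, etc. -/
def coreAt (i : ι) : Model κ E →L[ℂ] Model κ E :=
  match κ i with
  | .shift => forwardAt κ i
  | .backward => ContinuousLinearMap.adjoint (forwardAt κ i)
  | .truncated _ => forwardAt κ i

/-- The `i`-th diagonal operator with symbol `T`: `e_k ⊗ η ↦ e_k ⊗ T ^ (k i) η`,
where the basis of every factor is counted from `0`. -/
def diagAt (i : ι) (T : unitary (E →L[ℂ] E)) : Model κ E →L[ℂ] Model κ E :=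
  diag fun k => T ^ (κ i).val (k i)

/-- `1 ⊗ … ⊗ 1 ⊗ T`. -/
def lastAt (T : unitary (E →L[ℂ] E)) : Model κ E →L[ℂ] Model κ E :=
  diag fun _ => T

theorem forwardAt_elem (i : ι) (x : ∀ i, (κ i).Factor) (η : E) :
    forwardAt κ i (elem κ x η) = elem κ (Function.update x i ((κ i).forward (x i))) η := by
  classical
  ext k
  rw [forwardAt, pull_apply, elem_apply, elem_apply,
    ← Finset.mul_prod_erase _ _ (Finset.mem_univ i), ← Finset.mul_prod_erase _ _ (Finset.mem_univ i)]
  have h : ∀ (k' : ∀ i, (κ i).Idx) (y : (κ i).Factor), (∀ j, j ≠ i → k' j = k j) →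
      ∏ j ∈ Finset.univ.erase i, (Function.update x i y) j (k' j)
        = ∏ j ∈ Finset.univ.erase i, x j (k j) := fun k' y hk' =>
    Finset.prod_congr rfl fun j hj => by
      have hj' := Finset.ne_of_mem_erase hj
      rw [Function.update_of_ne hj', hk' j hj']
  have h1 := h k ((κ i).forward (x i)) fun _ _ => rfl
  have h2 := h (Function.update k i ((κ i).pred (k i))) (x i) fun j hj => Function.update_of_ne hj _ _
  rw [Function.update_eq_self] at h2
  rw [h1, h2, Function.update_self, Function.update_self, Kind.forward, pull_apply]
  by_cases hk : (κ i).val (k i) = 0 <;> simp [hk]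

theorem adjoint_forwardAt_elem (i : ι) (x : ∀ i, (κ i).Factor) (η : E) :
    ContinuousLinearMap.adjoint (forwardAt κ i) (elem κ x η)
      = elem κ (Function.update x i (ContinuousLinearMap.adjoint (κ i).forward (x i))) η := by
  have hd : Dense (Submodule.span ℂ {f : Model κ E | ∃ x η, f = elem κ x η} : Set (Model κ E)) :=
    Submodule.dense_iff_topologicalClosure_eq_top.mpr (elem_total κ)
  refine hd.eq_of_inner_right ℂ fun v hv => ?_
  rw [SetLike.mem_coe] at hv
  induction hv using Submodule.span_induction with
  | mem f hf =>
    obtain ⟨y, ξ, rfl⟩ := hf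
    change inner ℂ (elem κ y ξ) _ = inner ℂ (elem κ y ξ) _
    rw [ContinuousLinearMap.adjoint_inner_right, forwardAt_elem, inner_elem, inner_elem]
    congr 1
    refine Finset.prod_congr rfl fun j _ => ?_
    by_cases hj : j = i
    · subst hj
      simp [ContinuousLinearMap.adjoint_inner_right]
    · simp [hj]
  | zero => simp
  | add a b _ _ ha hb =>
    simp only [inner_add_left] at ha hb ⊢
    rw [ha, hb]
  | smul c a _ ha =>
    simp only [inner_smul_left] at ha ⊢
    rw [ha]

/-- `coreAt κ i` acts on elementary tensors through the operator `S`, `S*` or `J_p` on the `i`-th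
factor. -/
theorem coreAt_elem (i : ι) (x : ∀ i, (κ i).Factor) (η : E) :
    coreAt κ i (elem κ x η) = elem κ (Function.update x i ((κ i).core (x i))) η := by
  rw [Kind.core_eq]
  by_cases h : κ i = .backward
  · have hc : coreAt κ i = ContinuousLinearMap.adjoint (forwardAt (E := E) κ i) := by
      unfold coreAt
      split <;> simp_all
    rw [if_pos h, hc]
    exact adjoint_forwardAt_elem κ i x η
  · have hc : coreAt κ i = forwardAt (E := E) κ i := by
      unfold coreAt
      split <;> simp_all
    rw [if_neg h, hc]
    exact forwardAt_elem κ i x η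

/-- The defining formula of the diagonal operators. -/
theorem diagAt_single [DecidableEq (∀ i, (κ i).Idx)] (i : ι) (T : unitary (E →L[ℂ] E))
    (k : ∀ i, (κ i).Idx) (η : E) :
    diagAt κ i T (lp.single 2 k η)
      = lp.single 2 k (((T : E →L[ℂ] E) ^ (κ i).val (k i)) η) := by
  ext l
  rw [diagAt, diag_apply]
  by_cases h : l = k
  · subst h
    simp
  · simp [h]

theorem lastAt_elem (T : unitary (E →L[ℂ] E)) (x : ∀ i, (κ i).Factor) (η : E) :
    lastAt κ T (elem κ x η) = elem κ x ((T : E →L[ℂ] E) η) := by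
  ext k
  simp [lastAt, diag_apply, elem_apply]

end Model

/-! ### The model operators -/

section ModelOperators

variable {n : ℕ} {Φu : Finset (Fin n)} (κ : {i : Fin n // i ∉ Φu} → Kind)
variable {E : Type*} [NormedAddCommGroup E] [InnerProductSpace ℂ E] [CompleteSpace E]
variable (U : Fin n → Fin n → unitary (E →L[ℂ] E))

/-- The tensor factor of `i` precedes that of `j`: the factors are listed as first the shifts,
then the backward shifts, then the truncated shifts, and by increasing index in each group. -/
def Precedes (i j : {i : Fin n // i ∉ Φu}) : Prop :=
  (κ i).rank < (κ j).rank ∨ ((κ i).rank = (κ j).rank ∧ i.1 < j.1)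

/-- The diagonal operator contributed to `V j` by the factor `i`: `D(U_ij)` if `i` is a shift,
`D(U_ji)` if `i` is a backward shift, `d(U_ij)` if `i` is a truncated shift. -/
def twistAt (i : {i : Fin n // i ∉ Φu}) (j : Fin n) : Model κ E →L[ℂ] Model κ E :=
  match κ i with
  | .shift => diagAt κ i (U i j)
  | .backward => diagAt κ i (U j i)
  | .truncated _ => diagAt κ i (U i j)

open Classical in
/-- The (ordered) product of `twistAt κ U i j` over the non-unitary indices `i` satisfying `P`. -/
def twistProd (P : {i : Fin n // i ∉ Φu} → Prop) (j : Fin n) : Model κ E →L[ℂ] Model κ E :=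
  (List.ofFn fun i : Fin n =>
    if h : i ∉ Φu then (if P ⟨i, h⟩ then twistAt κ U ⟨i, h⟩ j else 1) else 1).prod

/-- The `j`-th model operator for a non-unitary index `j`: diagonal operators on the preceding
factors, `S`, `S*` or `J_p` on the factor `j`, the identity on the later factors and on `E`. -/
def modelNonUnitary (j : {i : Fin n // i ∉ Φu}) : Model κ E →L[ℂ] Model κ E :=
  twistProd κ U (fun i => Precedes κ i j) j * coreAt κ j

/-- The `j`-th model operator for a unitary index `j`: diagonal operators on all the factors,
and the unitary `T` on `E`. -/
def modelUnitary (j : Fin n) (T : unitary (E →L[ℂ] E)) : Model κ E →L[ℂ] Model κ E :=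
  twistProd κ U (fun _ => True) j * lastAt κ T

end ModelOperators

end

end TwistedPPI

namespace TwistedPPI

noncomputable section

/-! ### Irreducible families -/

section Irreducible

variable {ι : Type*} {H : Type*} [NormedAddCommGroup H] [InnerProductSpace ℂ H] [CompleteSpace H]

/-! Schur's lemma makes each twist `U i j` a scalar of modulus one: a unitary with two distinct
spectral points would give, by the continuous functional calculus, two non-zero operators with zero
product, each commuting with the family and its adjoints, and hence injective
(`IsIrreducibleFamily.exists_scalar`).

With scalar twists each operator has a pure type. A power partial isometry `A` with `ker A* ≠ 0` has
a wandering vector: some non-zero vector of `ker A*` generates under `A` a copy of the shift or of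
one `J_p` (`exists_wandering`). The other members of the family and their adjoints carry wandering
vectors of a given type to wandering vectors of that type, so the orbits of these span an invariant
subspace, which is dense by irreducibility (`exists_hasKind`). If only `ker A` is non-zero, the
argument applies to `A*`; if both kernels vanish, `A` is unitary.

Backward shifts are replaced by their adjoints, which at most conjugates the scalars. The space `Hu`
is the vacuum, the common kernel of the adjoints of the non-unitary members. It is non-zero and is
reduced by the unitary members. Ordered monomials in the non-unitary members map it isometrically
onto mutually orthogonal subspaces with dense span (`inner_monomial`, `dense_span_monomial`), so `H`
is `ℓ²` of the admissible exponents with values in the vacuum. An operator must be moved past the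
powers that stand before its own place in the monomial; the scalars so collected are the diagonal
operators of the model. Monomials applied to an invariant subspace of the vacuum are again total,
which gives irreducibility of the unitary part. -/

/-- For an irreducible family, a set with a non-zero element whose span is invariant is total. -/
theorem IsIrreducibleFamily.dense_span {A : ι → H →L[ℂ] H} (hA : IsIrreducibleFamily A)
    {S : Set H} (hne : ∃ x ∈ S, x ≠ 0)
    (hS : ∀ i, ∀ x ∈ S, A i x ∈ Submodule.span ℂ S ∧ star (A i) x ∈ Submodule.span ℂ S) :
    Dense (Submodule.span ℂ S : Set H) := by
  have key : ∀ B : H →L[ℂ] H, (∀ x ∈ S, B x ∈ Submodule.span ℂ S) →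
      ∀ x ∈ (Submodule.span ℂ S).topologicalClosure,
        B x ∈ (Submodule.span ℂ S).topologicalClosure := by
    intro B hB x hx
    refine map_mem_closure B.continuous hx fun y hy => ?_
    have h : Submodule.span ℂ S ≤ (Submodule.span ℂ S).comap (B : H →ₗ[ℂ] H) :=
      Submodule.span_le.mpr hB
    exact h hy
  rw [Submodule.dense_iff_topologicalClosure_eq_top]
  refine (hA.2 _ (Submodule.isClosed_topologicalClosure _) fun i x hx =>
    ⟨key _ (fun y hy => (hS i y hy).1) x hx, key _ (fun y hy => (hS i y hy).2) x hx⟩).resolve_left ?_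
  obtain ⟨x, hx, hx0⟩ := hne
  intro h
  have hx' : x ∈ (Submodule.span ℂ S).topologicalClosure :=
    Submodule.le_topologicalClosure _ (Submodule.subset_span hx)
  rw [h] at hx'
  exact hx0 ((Submodule.mem_bot ℂ).mp hx')

/-- An operator commuting with an irreducible family and with its adjoints is zero or injective. -/
theorem IsIrreducibleFamily.ker_eq_bot {A : ι → H →L[ℂ] H} (hA : IsIrreducibleFamily A)
    {B : H →L[ℂ] H} (hB : ∀ i, Commute B (A i)) (hB' : ∀ i, Commute B (star (A i))) (h0 : B ≠ 0)
    {x : H} (hx : B x = 0) : x = 0 := by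
  have comm : ∀ {C : H →L[ℂ] H}, Commute B C → ∀ y, B y = 0 → B (C y) = 0 := by
    intro C hC y hy
    have h := congrArg (fun X : H →L[ℂ] H => X y) hC.eq
    simpa [hy] using h
  rcases hA.2 (LinearMap.ker (B : H →ₗ[ℂ] H)) B.isClosed_ker fun i y hy =>
    ⟨comm (hB i) y hy, comm (hB' i) y hy⟩ with h | h
  · have hx' : x ∈ LinearMap.ker (B : H →ₗ[ℂ] H) := hx
    rw [h] at hx'
    exact (Submodule.mem_bot ℂ).mp hx'
  · refine absurd (ContinuousLinearMap.ext fun y => ?_) h0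
    have hy : y ∈ LinearMap.ker (B : H →ₗ[ℂ] H) := by rw [h]; trivial
    exact hy

/-- Schur's lemma for a unitary commuting with an irreducible family. -/
theorem IsIrreducibleFamily.exists_scalar {A : ι → H →L[ℂ] H} (hA : IsIrreducibleFamily A)
    (u : unitary (H →L[ℂ] H)) (hu : ∀ i, Commute (A i) (u : H →L[ℂ] H)) :
    ∃ z : unitary ℂ, (u : H →L[ℂ] H) = algebraMap ℂ (H →L[ℂ] H) z := by
  have := hA.1
  set a : H →L[ℂ] H := (u : H →L[ℂ] H) with ha
  have hn : IsStarNormal a := ⟨by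
    exact (Unitary.coe_star_mul_self u).trans (Unitary.coe_mul_star_self u).symm⟩
  -- Since `a` is unitary, conjugating `B * a = a * B` by `star a` suffices; Fuglede's theorem is
  -- not needed.
  have hstar : ∀ B : H →L[ℂ] H, Commute B a → Commute B (star a) := by
    intro B hB
    have h1 : star a * a = 1 := Unitary.coe_star_mul_self u
    have h2 : a * star a = 1 := Unitary.coe_mul_star_self u
    calc B * star a = star a * a * B * star a := by rw [h1, one_mul]
      _ = star a * (B * a) * star a := by rw [hB.eq]; noncomm_ring
      _ = star a * B * (a * star a) := by noncomm_ring
      _ = star a * B := by rw [h2, mul_one]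
  have hcfc : ∀ (f : ℂ → ℂ) i, Commute (cfc f a) (A i) ∧ Commute (cfc f a) (star (A i)) := by
    intro f i
    have h1 := hu i
    have h2 := hstar _ h1
    have h3 : Commute (star (A i)) (star a) := h1.star_star
    have h4 : Commute (star (A i)) a := by simpa using h2.star_star
    exact ⟨Commute.cfc h1.symm h2.symm f, Commute.cfc h4.symm h3.symm f⟩
  -- Tent functions of radius half the distance, centred at two spectral points, have product zero.
  -- Each gives a non-zero operator, and the first of these is injective by `ker_eq_bot`, which
  -- forces the second to vanish.
  have hsub : (spectrum ℂ a).Subsingleton := by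
    intro z hz w hw
    by_contra hzw
    have hr : 0 < dist z w := dist_pos.mpr hzw
    let f : ℂ → ℂ → ℂ := fun v x => ((max 0 (dist z w / 2 - dist x v) : ℝ) : ℂ)
    have hf : ∀ v, Continuous (f v) := fun v => by fun_prop
    have hne : ∀ v ∈ spectrum ℂ a, cfc (f v) a ≠ 0 := by
      intro v hv h0
      rw [← cfc_const_zero ℂ a] at h0
      have h1 := eqOn_of_cfc_eq_cfc h0 (hf v).continuousOn continuousOn_const hn hv
      have h2 : max 0 (dist z w / 2) = 0 := by simpa [f] using h1
      have h3 := le_max_right 0 (dist z w / 2)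
      linarith
    have hmul : cfc (f z) a * cfc (f w) a = 0 := by
      rw [← cfc_mul (f z) (f w) a (hf z).continuousOn (hf w).continuousOn, ← cfc_const_zero ℂ a]
      refine cfc_congr fun x _ => ?_
      have h1 : dist z w ≤ dist x z + dist x w := dist_triangle_left z w x
      rcases le_total (dist z w / 2) (dist x z) with h | h
      · have : f z x = 0 := by simp only [f, Complex.ofReal_eq_zero]; exact max_eq_left (by linarith)
        simp [this]
      · have : f w x = 0 := by simp only [f, Complex.ofReal_eq_zero]; exact max_eq_left (by linarith)
        simp [this]
    refine hne w hw (ContinuousLinearMap.ext fun x => ?_)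
    exact hA.ker_eq_bot (fun i => (hcfc (f z) i).1) (fun i => (hcfc (f z) i).2) (hne z hz)
      (congrArg (fun X : H →L[ℂ] H => X x) hmul)
  obtain ⟨z, hz⟩ := spectrum.nonempty a
  have haz : a = algebraMap ℂ (H →L[ℂ] H) z := by
    rw [← cfc_const z a, ← cfc_id' ℂ a]
    conv_rhs => rw [cfc_id' ℂ a]
    exact cfc_congr fun x hx => hsub hx hz
  have hinj := (algebraMap ℂ (H →L[ℂ] H)).injective
  have hs : star (algebraMap ℂ (H →L[ℂ] H) z) = algebraMap ℂ (H →L[ℂ] H) (star z) :=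
    (algebraMap_star_comm z).symm
  refine ⟨⟨z, Unitary.mem_iff.mpr ⟨hinj ?_, hinj ?_⟩⟩, haz⟩
  · rw [map_mul, ← hs, ← haz, map_one]
    exact Unitary.coe_star_mul_self u
  · rw [map_mul, ← hs, ← haz, map_one]
    exact Unitary.coe_mul_star_self u

end Irreducible

/-! ### Families with scalar twists -/

section ScalarTwisted

variable {ι : Type*} {H : Type*} [NormedAddCommGroup H] [InnerProductSpace ℂ H] [CompleteSpace H]

theorem IsPowerPartialIsometry.adjoint {V : H →L[ℂ] H} (hV : IsPowerPartialIsometry V) :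
    IsPowerPartialIsometry (star V) := by
  intro m
  have h := congrArg Star.star (hV m)
  simp only [IsPartialIsometry, star_mul, star_star, star_pow] at h ⊢
  rw [← mul_assoc] at h
  exact h

/-- `A` is a family of power partial isometries twisted by scalars `c i j` of modulus one. -/
structure ScalarTwisted (c : ι → ι → unitary ℂ) (A : ι → H →L[ℂ] H) : Prop where
  symm : ∀ i j, i ≠ j → c j i = star (c i j)
  powerPartialIsometry : ∀ i, IsPowerPartialIsometry (A i)
  star_mul : ∀ i j, i ≠ j → star (A i) * A j = (c i j : ℂ) • (A j * star (A i))
  mul : ∀ i j, i ≠ j → A i * A j = (c j i : ℂ) • (A j * A i)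

namespace ScalarTwisted

variable {c : ι → ι → unitary ℂ} {A : ι → H →L[ℂ] H}

theorem star_mul_star (hA : ScalarTwisted c A) {i j : ι} (h : i ≠ j) :
    star (A i) * star (A j) = (c j i : ℂ) • (star (A j) * star (A i)) := by
  have h1 := congrArg Star.star (hA.mul j i h.symm)
  simp only [StarMul.star_mul, star_smul] at h1
  rw [h1, hA.symm i j h]
  rfl

theorem mul_star (hA : ScalarTwisted c A) {i j : ι} (h : i ≠ j) :
    A i * star (A j) = (c i j : ℂ) • (star (A j) * A i) := by
  have h1 := hA.star_mul j i h.symm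
  rw [h1, smul_smul, hA.symm i j h, ← Submonoid.coe_mul]
  simp

/-- Replacing some of the operators by their adjoints. -/
theorem flip (hA : ScalarTwisted c A) (ε : ι → Bool) :
    ScalarTwisted (fun i j => if ε i = ε j then c i j else star (c i j))
      (fun i => if ε i then A i else star (A i)) where
  symm i j h := by
    by_cases h' : ε i = ε j
    · simp [h', hA.symm i j h]
    · simp [h', Ne.symm h', hA.symm i j h]
  powerPartialIsometry i := by
    cases ε i <;> simp [hA.powerPartialIsometry i, (hA.powerPartialIsometry i).adjoint]
  star_mul i j h := by
    cases ε i <;> cases ε j <;> simp only [if_true, if_false, star_star, Bool.false_eq_true,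
      Bool.true_eq_false]
    · exact hA.mul_star h
    · rw [← hA.symm i j h]; exact hA.mul i j h
    · rw [← hA.symm i j h]; exact hA.star_mul_star h
    · exact hA.star_mul i j h
  mul i j h := by
    cases ε i <;> cases ε j <;> simp only [if_true, if_false, Bool.false_eq_true,
      Bool.true_eq_false]
    · exact hA.star_mul_star h
    · rw [← hA.symm j i h.symm]; exact hA.star_mul i j h
    · rw [← hA.symm j i h.symm]; exact hA.mul_star h
    · exact hA.mul i j h

end ScalarTwisted

theorem IsIrreducibleFamily.flip {A : ι → H →L[ℂ] H} (hA : IsIrreducibleFamily A) (ε : ι → Bool) :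
    IsIrreducibleFamily (fun i => if ε i then A i else star (A i)) := by
  refine ⟨hA.1, fun M hM h => hA.2 M hM fun i x hx => ?_⟩
  have h' := h i x hx
  cases hi : ε i
  · simp only [hi, Bool.false_eq_true, if_false, star_star] at h'
    exact h'.symm
  · simpa only [hi, if_true] using h'

/-- The twists of an irreducible twisted family are scalars. -/
theorem IsTwistedFamily.exists_scalarTwisted {U : ι → ι → unitary (H →L[ℂ] H)}
    {V : ι → H →L[ℂ] H} (hV : IsTwistedFamily U V) (hirr : IsIrreducibleFamily V) :
    ∃ c : ι → ι → unitary ℂ, ScalarTwisted c V ∧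
      ∀ i j, i ≠ j → (U i j : H →L[ℂ] H) = algebraMap ℂ (H →L[ℂ] H) (c i j) := by
  classical
  have := hirr.1
  have hex : ∀ i j, ∃ z : unitary ℂ, i ≠ j → (U i j : H →L[ℂ] H) = algebraMap ℂ (H →L[ℂ] H) z := by
    intro i j
    by_cases h : i = j
    · exact ⟨1, fun h' => absurd h h'⟩
    · obtain ⟨z, hz⟩ := hirr.exists_scalar (U i j) fun k => hV.commute i j k h
      exact ⟨z, fun _ => hz⟩
  choose c hc using hex
  refine ⟨c, ⟨fun i j h => ?_, hV.powerPartialIsometry, fun i j h => ?_, fun i j h => ?_⟩, hc⟩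
  · apply Subtype.ext
    apply (algebraMap ℂ (H →L[ℂ] H)).injective
    rw [← hc j i h.symm, hV.system.adjoint_eq i j h, Unitary.coe_star, hc i j h, Unitary.coe_star,
      algebraMap_star_comm]
  · rw [hV.star_mul i j h, hc i j h, Algebra.smul_def, mul_assoc]
  · rw [hV.mul i j h, hc j i h.symm, Algebra.smul_def, mul_assoc]

end ScalarTwisted

/-! ### Structure of a single power partial isometry -/

section SingleOperator

variable {H : Type*} [NormedAddCommGroup H] [InnerProductSpace ℂ H] [CompleteSpace H]

theorem mul_pow_of_twist {X A : H →L[ℂ] H} {d : ℂ} (h : X * A = d • (A * X)) (m : ℕ) :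
    X * A ^ m = d ^ m • (A ^ m * X) := by
  induction m with
  | zero => simp
  | succ m ih =>
    rw [pow_succ, ← mul_assoc, ih, smul_mul_assoc, mul_assoc, h, mul_smul_comm, smul_smul,
      ← mul_assoc, pow_succ]

/-- For projections with `P * Q` idempotent, expanding shows that `Q * P - P * Q * P` has zero
square modulus, so `Q * P = P * Q * P` is self-adjoint. -/
theorem commute_of_mul_mul_mul_eq {P Q : H →L[ℂ] H} (hPP : P * P = P) (hQQ : Q * Q = Q)
    (hPs : star P = P) (hQs : star Q = Q) (hPQ : P * Q * P * Q = P * Q) : Commute P Q := by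
  have h0 : Q * P - P * Q * P = 0 := by
    rw [← CStarRing.star_mul_self_eq_zero_iff]
    rw [star_sub, star_mul, star_mul, star_mul, hPs, hQs]
    calc (P * Q - P * (Q * P)) * (Q * P - P * Q * P)
        = P * (Q * Q) * P - P * Q * P * Q * P - P * Q * P * Q * P
          + P * Q * (P * P) * Q * P := by
          noncomm_ring
      _ = 0 := by rw [hPP, hQQ, hPQ]; noncomm_ring
  have h1 : Q * P = P * Q * P := sub_eq_zero.mp h0
  have h2 := congrArg star h1
  simp only [star_mul, hPs, hQs] at h2
  rw [commute_iff_eq, h1, mul_assoc]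
  exact h2

/-- If the product of two partial isometries `A` and `B` is a partial isometry, then the initial
projection of `A` commutes with the final projection of `B`. -/
theorem IsPartialIsometry.commute {A B : H →L[ℂ] H} (hA : IsPartialIsometry A)
    (hB : IsPartialIsometry B) (hAB : IsPartialIsometry (A * B)) :
    Commute (star A * A) (B * star B) := by
  refine commute_of_mul_mul_mul_eq ?_ ?_ (by simp) (by simp) ?_
  · calc star A * A * (star A * A) = star A * (A * star A * A) := by noncomm_ring
      _ = star A * A := by rw [hA]
  · calc B * star B * (B * star B) = (B * star B * B) * star B := by noncomm_ring
      _ = B * star B := by rw [hB]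
  · have h : A * B * star (A * B) * (A * B) = A * B := hAB
    rw [star_mul] at h
    calc star A * A * (B * star B) * (star A * A) * (B * star B)
        = star A * (A * B * (star B * star A) * (A * B)) * star B := by noncomm_ring
      _ = star A * A * (B * star B) := by rw [h]; noncomm_ring

/-- The product `A ^ m * A` is again a partial isometry, so the preceding criterion applies. -/
theorem IsPowerPartialIsometry.commute {A : H →L[ℂ] H} (hA : IsPowerPartialIsometry A) (m : ℕ) :
    Commute (star A ^ m * A ^ m) (A * star A) := by
  have h1 : IsPartialIsometry A := by simpa using hA 1
  have h := IsPartialIsometry.commute (hA m) h1 (by rw [← pow_succ]; exact hA (m + 1))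
  rwa [star_pow] at h

theorem IsPowerPartialIsometry.isPartialIsometry {A : H →L[ℂ] H} (hA : IsPowerPartialIsometry A) :
    A * star A * A = A := by
  have h := hA 1
  rwa [pow_one] at h

theorem IsPowerPartialIsometry.pow_mul_star_pow_mul_pow {A : H →L[ℂ] H}
    (hA : IsPowerPartialIsometry A) (m : ℕ) : A ^ m * star A ^ m * A ^ m = A ^ m := by
  have h := hA m
  rwa [IsPartialIsometry, star_pow] at h

/-- The initial projections of the powers decrease. -/
theorem IsPowerPartialIsometry.initial_mul {A : H →L[ℂ] H} (hA : IsPowerPartialIsometry A)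
    {k m : ℕ} (h : k ≤ m) :
    star A ^ k * A ^ k * (star A ^ m * A ^ m) = star A ^ m * A ^ m := by
  obtain ⟨r, rfl⟩ := Nat.exists_eq_add_of_le h
  have h1 := congrArg star (hA.pow_mul_star_pow_mul_pow k)
  simp only [star_mul, star_pow, star_star] at h1
  rw [pow_add (star A) k r]
  calc star A ^ k * A ^ k * (star A ^ k * star A ^ r * A ^ (k + r))
      = star A ^ k * (A ^ k * star A ^ k) * star A ^ r * A ^ (k + r) := by noncomm_ring
    _ = star A ^ k * star A ^ r * A ^ (k + r) := by rw [h1]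

/-- The power partial isometry `A` is a multiple of the model operator `Kind.forward κ`. -/
structure HasKind (κ : Kind) (A : H →L[ℂ] H) : Prop where
  star_pow_pow : ∀ z, star A z = 0 → ∀ m ∈ Set.range κ.val, (star A ^ m) ((A ^ m) z) = z
  pow_eq_zero : ∀ m ∉ Set.range κ.val, A ^ m = 0
  eq_zero : ∀ x, (∀ m : ℕ, (1 - A * star A) ((star A ^ m) x) = 0) → x = 0

theorem Kind.mem_range_of_succ_mem {κ : Kind} {m : ℕ} (h : m + 1 ∈ Set.range κ.val) :
    m ∈ Set.range κ.val := by
  obtain ⟨a, ha⟩ := h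
  exact ⟨κ.pred a, by rw [Kind.val_pred, ha, Nat.add_sub_cancel]⟩

theorem Kind.zero_mem_range (κ : Kind) : 0 ∈ Set.range κ.val := by
  cases κ with
  | shift => exact ⟨(0 : ℕ), rfl⟩
  | backward => exact ⟨(0 : ℕ), rfl⟩
  | truncated p => exact ⟨(⟨0, p.pos⟩ : Fin p), rfl⟩

theorem Kind.mem_range_shift (m : ℕ) : m ∈ Set.range Kind.shift.val := ⟨(m : ℕ), rfl⟩

theorem Kind.mem_range_truncated {p : ℕ+} {m : ℕ} :
    m ∈ Set.range (Kind.truncated p).val ↔ m < p :=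
  ⟨fun ⟨a, ha⟩ => ha ▸ Fin.is_lt a, fun h => ⟨(⟨m, h⟩ : Fin p), rfl⟩⟩

/-- The vectors in the kernel of `A*` that generate a copy of `Kind.forward κ` under `A`. -/
def wandering (κ : Kind) (A : H →L[ℂ] H) : Set H :=
  {y | star A y = 0 ∧ (∀ m ∈ Set.range κ.val, (star A ^ m * A ^ m) y = y) ∧
    ∀ m ∉ Set.range κ.val, (A ^ m) y = 0}

/-- The initial projection of `A` commutes with the final projection of `A ^ m`, because `A * A ^ m`
is a partial isometry. Hence `A*` lowers the exponent by one on vectors fixed by the initial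
projection of `A ^ (m + 1)`. -/
theorem IsPowerPartialIsometry.star_mul_pow_succ {A : H →L[ℂ] H} (hA : IsPowerPartialIsometry A)
    (m : ℕ) : star A * A ^ (m + 1) = A ^ m * (star A ^ (m + 1) * A ^ (m + 1)) := by
  have h1 : IsPartialIsometry A := by simpa using hA 1
  have h := (IsPartialIsometry.commute h1 (hA m) (by rw [← pow_succ']; exact hA (m + 1))).eq
  rw [star_pow] at h
  calc star A * A ^ (m + 1) = star A * A * (A ^ m * star A ^ m * A ^ m) := by
        rw [hA.pow_mul_star_pow_mul_pow, pow_succ', mul_assoc]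
    _ = star A * A * (A ^ m * star A ^ m) * A ^ m := by noncomm_ring
    _ = A ^ m * star A ^ m * (star A * A) * A ^ m := by rw [h]
    _ = _ := by rw [pow_succ, pow_succ']; noncomm_ring

theorem HasKind.star_pow_succ_apply {κ : Kind} {A : H →L[ℂ] H} (hκ : HasKind κ A)
    (hA : IsPowerPartialIsometry A) {z : H} (hz : star A z = 0) {m : ℕ}
    (hm : m + 1 ∈ Set.range κ.val) : star A ((A ^ (m + 1)) z) = (A ^ m) z := by
  have h := congrArg (fun X : H →L[ℂ] H => X z) (hA.star_mul_pow_succ m)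
  simpa only [mul_apply_eq_comp, hκ.star_pow_pow z hz _ hm] using h

/-- Inner products of powers applied to the kernel of the adjoint. -/
theorem HasKind.inner_pow_pow {κ : Kind} {A : H →L[ℂ] H} (hκ : HasKind κ A)
    (hA : IsPowerPartialIsometry A) {z w : H} (hz : star A z = 0) (hw : star A w = 0) {a : ℕ}
    (ha : a ∈ Set.range κ.val) (b : ℕ) :
    inner ℂ ((A ^ a) z) ((A ^ b) w) = if a = b then inner ℂ z w else 0 := by
  have adj : ∀ x y : H, inner ℂ (A x) y = inner ℂ x (star A y) := fun x y =>
    (ContinuousLinearMap.adjoint_inner_right A x y).symm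
  have adj' : ∀ x y : H, inner ℂ x (A y) = inner ℂ (star A x) y := fun x y =>
    (ContinuousLinearMap.adjoint_inner_left A y x).symm
  induction a generalizing b with
  | zero =>
    cases b with
    | zero => simp
    | succ b =>
      rw [pow_succ' A b, mul_apply_eq_comp, adj', pow_zero,
        one_apply_eq_self, hz, inner_zero_left]
      simp
  | succ a ih =>
    cases b with
    | zero =>
      rw [pow_succ' A a, mul_apply_eq_comp, adj, pow_zero,
        one_apply_eq_self, hw, inner_zero_right]
      simp
    | succ b =>
      rw [pow_succ' A b, mul_apply_eq_comp, adj', hκ.star_pow_succ_apply hA hz ha,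
        ih (Kind.mem_range_of_succ_mem ha)]
      simp

/-- A power partial isometry with non-zero kernel of the adjoint has a non-zero wandering vector. -/
theorem IsPowerPartialIsometry.exists_wandering {A : H →L[ℂ] H} (hA : IsPowerPartialIsometry A)
    {x : H} (hx0 : x ≠ 0) (hx : star A x = 0) :
    ∃ κ : Kind, κ ≠ .backward ∧ ∃ y ∈ wandering κ A, y ≠ 0 := by
  by_contra! hcon
  -- If no truncated type has a non-zero wandering vector, no initial projection can be the first to
  -- move `x`; then `x` itself is wandering for the shift.
  have hF : ∀ m : ℕ, (star A ^ m * A ^ m) x = x := by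
    intro m
    induction m with
    | zero => simp
    | succ m ih =>
      have hle : ∀ k ≤ m + 1, (star A ^ k * A ^ k) ((star A ^ (m + 1) * A ^ (m + 1)) x)
          = (star A ^ (m + 1) * A ^ (m + 1)) x := fun k hk =>
        congrArg (fun X : H →L[ℂ] H => X x) (hA.initial_mul hk)
      have hle' : ∀ k ≤ m, (star A ^ k * A ^ k) x = x := fun k hk => by
        have h := congrArg (fun X : H →L[ℂ] H => X x) (hA.initial_mul hk)
        rwa [mul_apply_eq_comp, ih] at h
      -- The defect of `x` at the first possible failure: the powers `0, …, m` act on it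
      -- isometrically and `A ^ (m + 1)` kills it, so `p = m + 1`.
      have hmem : x - (star A ^ (m + 1) * A ^ (m + 1)) x
          ∈ wandering (.truncated ⟨m + 1, m.succ_pos⟩) A := by
        refine ⟨?_, fun k hk => ?_, fun k hk => ?_⟩
        -- The initial projection commutes with `A * star A`, so it preserves `ker (A * star A) =
        -- ker A*`.
        · have h1 := congrArg (fun X : H →L[ℂ] H => star A (X x)) (hA.commute (m + 1)).eq
          have h2 := congrArg (fun X : H →L[ℂ] H => X ((star A ^ (m + 1) * A ^ (m + 1)) x))
            hA.adjoint.isPartialIsometry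
          rw [star_star] at h2
          simp only [mul_apply_eq_comp, hx, map_zero] at h1 h2
          rw [map_sub, hx, zero_sub, neg_eq_zero, mul_apply_eq_comp, ← h2, ← h1]
        · have hk' : k < m + 1 := Kind.mem_range_truncated.mp hk
          rw [map_sub, hle k hk'.le, hle' k (by omega)]
        · have hk' : m + 1 ≤ k := by
            by_contra! h
            exact hk (Kind.mem_range_truncated.mpr h)
          obtain ⟨r, rfl⟩ := Nat.exists_eq_add_of_le' hk'
          have h := congrArg (fun X : H →L[ℂ] H => X x) (hA.pow_mul_star_pow_mul_pow (m + 1))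
          simp only [mul_apply_eq_comp] at h
          rw [pow_add, mul_apply_eq_comp, map_sub, mul_apply_eq_comp, h,
            sub_self, map_zero]
      exact (sub_eq_zero.mp (hcon _ (by simp) _ hmem)).symm
  exact hx0 (hcon .shift (by simp) x ⟨hx, fun m _ => hF m,
    fun m hm => absurd (Kind.mem_range_shift m) hm⟩)

end SingleOperator

/-! ### Types of the members of an irreducible scalar-twisted family -/

section Family

variable {ι : Type*} {H : Type*} [NormedAddCommGroup H] [InnerProductSpace ℂ H] [CompleteSpace H]
variable {c : ι → ι → unitary ℂ} {A : ι → H →L[ℂ] H}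

/-- The scalars `d` and `star d` cancel in `star A ^ m * A ^ m`, so `B` commutes with all initial
projections. It preserves the kernels of `A*` and of the powers of `A` because the scalars are
non-zero. -/
theorem mem_wandering_of_twist {κ : Kind} {A B : H →L[ℂ] H} {d : unitary ℂ}
    (h1 : B * A = (d : ℂ) • (A * B)) (h2 : B * star A = (star d : ℂ) • (star A * B))
    {y : H} (hy : y ∈ wandering κ A) : B y ∈ wandering κ A := by
  have hd : ∀ m : ℕ, (star d : ℂ) ^ m * (d : ℂ) ^ m = 1 := fun m => by
    rw [← mul_pow, Unitary.coe_star_mul_self, one_pow]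
  have hd' : (d : ℂ) ≠ 0 := fun h => by simpa [h] using hd 1
  have hs' : (star d : ℂ) ≠ 0 := fun h => by simpa [h] using hd 1
  have ap : ∀ {e : ℂ} {X Y : H →L[ℂ] H}, X = e • Y → ∀ y, X y = e • Y y := by
    rintro e X Y rfl y
    rfl
  refine ⟨?_, fun m hm => ?_, fun m hm => ?_⟩
  · have h := ap h2 y
    simp only [mul_apply_eq_comp, hy.1, map_zero] at h
    exact (smul_eq_zero.mp h.symm).resolve_left hs'
  · have h : B * (star A ^ m * A ^ m) = star A ^ m * A ^ m * B := by
      rw [← mul_assoc, mul_pow_of_twist h2 m, smul_mul_assoc, mul_assoc, mul_pow_of_twist h1 m,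
        mul_smul_comm, smul_smul, hd, one_smul, mul_assoc]
    have h' := congrArg (fun X : H →L[ℂ] H => X y) h
    rw [mul_apply_eq_comp, hy.2.1 m hm] at h'
    exact h'.symm
  · have h := ap (mul_pow_of_twist h1 m) y
    simp only [mul_apply_eq_comp, hy.2.2 m hm, map_zero] at h
    exact (smul_eq_zero.mp h.symm).resolve_left (pow_ne_zero m hd')

/-- In an irreducible twisted family, an operator with non-zero kernel of the adjoint is a multiple
of a shift or of a truncated shift. -/
theorem ScalarTwisted.exists_hasKind (hA : ScalarTwisted c A) (hirr : IsIrreducibleFamily A)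
    {i : ι} {x : H} (hx0 : x ≠ 0) (hx : star (A i) x = 0) :
    ∃ κ : Kind, κ ≠ .backward ∧ HasKind κ (A i) := by
  obtain ⟨κ, hκ, y, hy, hy0⟩ := (hA.powerPartialIsometry i).exists_wandering hx0 hx
  have hppi := hA.powerPartialIsometry i
  refine ⟨κ, hκ, ?_⟩
  -- The orbits of all wandering vectors of the chosen type. Taking all of them, rather than the
  -- orbit of `y`, makes the span invariant under the other members too.
  set S : Set H := {z | ∃ m, ∃ y ∈ wandering κ (A i), z = (A i ^ m) y} with hS
  have hdense : Dense (Submodule.span ℂ S : Set H) := by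
    refine hirr.dense_span ⟨y, ⟨0, y, hy, by simp⟩, hy0⟩ ?_
    rintro j _ ⟨m, z, hz, rfl⟩
    have tw : ∀ (B : H →L[ℂ] H) (d : unitary ℂ), B * A i = (d : ℂ) • (A i * B) →
        B * star (A i) = (star d : ℂ) • (star (A i) * B) →
        B ((A i ^ m) z) ∈ Submodule.span ℂ S := by
      intro B d h1 h2
      have h : B ((A i ^ m) z) = (d : ℂ) ^ m • (A i ^ m) (B z) :=
        congrArg (fun X : H →L[ℂ] H => X z) (mul_pow_of_twist h1 m)
      rw [h]
      exact Submodule.smul_mem _ _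
        (Submodule.subset_span ⟨m, B z, mem_wandering_of_twist h1 h2 hz, rfl⟩)
    by_cases hij : j = i
    · subst hij
      refine ⟨Submodule.subset_span ⟨m + 1, z, hz, by rw [pow_succ']; rfl⟩, ?_⟩
      cases m with
      | zero => simp [hz.1]
      | succ m =>
        by_cases hm : m + 1 ∈ Set.range κ.val
        · have h := congrArg (fun X : H →L[ℂ] H => X z) (hppi.star_mul_pow_succ m)
          simp only [mul_apply_eq_comp (star (A j)), mul_apply_eq_comp
            (A j ^ m), hz.2.1 _ hm] at h
          rw [h]
          exact Submodule.subset_span ⟨m, z, hz, rfl⟩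
        · simp [hz.2.2 _ hm]
    · refine ⟨tw (A j) (c i j) (hA.mul j i hij) ?_, tw (star (A j)) (c j i) (hA.star_mul j i hij) ?_⟩
      · rw [hA.mul_star hij, hA.symm i j (Ne.symm hij)]
        rfl
      · rw [hA.star_mul_star hij, hA.symm j i hij]
        rfl
  have hzero : ∀ z ∈ S, ∀ m ∉ Set.range κ.val, (A i ^ m) z = 0 := by
    rintro _ ⟨k, z, hz, rfl⟩ m hm
    rw [← mul_apply_eq_comp, ← pow_add, add_comm, pow_add,
      mul_apply_eq_comp, hz.2.2 m hm, map_zero]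
  refine ⟨fun z hz m hm => ?_, fun m hm => ?_, fun z hz => ?_⟩
  -- `1 - A A*` is the projection onto `ker A*`. On the total set `S` it keeps the wandering vectors
  -- and kills their images under positive powers, so the identity needs checking only on wandering
  -- vectors.
  · have h : star (A i) ^ m * A i ^ m * (1 - A i * star (A i)) = 1 - A i * star (A i) := by
      refine ContinuousLinearMap.ext_on hdense ?_
      rintro _ ⟨k, z, hz, rfl⟩
      have h0 : (1 - A i * star (A i)) ((A i ^ k) z) = if k = 0 then z else 0 := by
        cases k with
        | zero => simp [hz.1]
        | succ k =>
          have h1 := hppi.isPartialIsometry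
          have h2 : (1 - A i * star (A i)) * A i ^ (k + 1) = 0 := by
            rw [pow_succ', ← mul_assoc, sub_mul, h1, one_mul, sub_self, zero_mul]
          simpa using congrArg (fun X : H →L[ℂ] H => X z) h2
      rw [mul_apply_eq_comp, h0]
      split_ifs
      · exact hz.2.1 m hm
      · simp
    have h' := congrArg (fun X : H →L[ℂ] H => X z) h
    simpa [hz] using h'
  · exact ContinuousLinearMap.ext_on hdense fun z hz => by simpa using hzero z hz m hm
  -- Moving `A ^ m` and then the projection `1 - A A*`, which fixes `y`, to the other side shows
  -- that such a `z` is orthogonal to `S`.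
  · refine hdense.eq_zero_of_inner_right ℂ fun w hw => ?_
    rw [SetLike.mem_coe] at hw
    induction hw using Submodule.span_induction with
    | mem w hw =>
      obtain ⟨m, y, hy, rfl⟩ := hw
      have h1 : (1 - A i * star (A i)) y = y := by simp [hy.1]
      have h2 : star (1 - A i * star (A i)) = 1 - A i * star (A i) := by simp
      have h3 : star (A i ^ m) = star (A i) ^ m := star_pow _ _
      calc inner ℂ ((A i ^ m) y) z = inner ℂ y ((star (A i) ^ m) z) := by
            rw [← h3]; exact (ContinuousLinearMap.adjoint_inner_right _ _ _).symm
        _ = inner ℂ ((1 - A i * star (A i)) y) ((star (A i) ^ m) z) := by rw [h1]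
        _ = inner ℂ y ((1 - A i * star (A i)) ((star (A i) ^ m) z)) := by
            conv_rhs => rw [← h2]
            exact (ContinuousLinearMap.adjoint_inner_right _ _ _).symm
        _ = 0 := by rw [hz m, inner_zero_right]
    | zero => simp
    | add a b _ _ ha hb => rw [inner_add_left, ha, hb, add_zero]
    | smul e a _ ha => rw [inner_smul_left, ha, mul_zero]

/-- The members of an irreducible twisted family are unitaries or multiples of shifts, of truncated
shifts, or of backward shifts. -/
theorem ScalarTwisted.unitary_or_hasKind (hA : ScalarTwisted c A) (hirr : IsIrreducibleFamily A)
    (i : ι) : A i ∈ unitary (H →L[ℂ] H) ∨ (∃ κ : Kind, κ ≠ .backward ∧ HasKind κ (A i)) ∨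
      HasKind .backward (star (A i)) := by
  classical
  have := hirr.1
  by_cases h1 : ∃ x, x ≠ 0 ∧ star (A i) x = 0
  · obtain ⟨x, hx0, hx⟩ := h1
    exact Or.inr (Or.inl (hA.exists_hasKind hirr hx0 hx))
  by_cases h2 : ∃ x, x ≠ 0 ∧ A i x = 0
  · obtain ⟨x, hx0, hx⟩ := h2
    -- Only the member `i` is replaced by its adjoint.
    obtain ⟨κ, hκ, h⟩ := (hA.flip fun j => decide (j ≠ i)).exists_hasKind
      (hirr.flip fun j => decide (j ≠ i)) (i := i) hx0 (by simpa using hx)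
    simp only [ne_eq, not_true_eq_false, decide_false, Bool.false_eq_true, if_false] at h
    refine Or.inr (Or.inr ?_)
    cases κ with
    -- Both types have all of `ℕ` as positions, so the three conditions coincide.
    | shift => exact ⟨h.1, h.2, h.3⟩
    | backward => exact absurd rfl hκ
    | truncated p =>
      -- A truncated type would make `star (A i)` nilpotent, whereas it is injective on a non-zero
      -- space.
      have hp := h.pow_eq_zero p fun h' => lt_irrefl _ (Kind.mem_range_truncated.mp h')
      refine absurd (fun m => ?_ : ∀ m : ℕ, star (A i) ^ m ≠ 0) fun h' => h' p hp
      obtain ⟨v, hv⟩ := exists_ne (0 : H)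
      have hm : (star (A i) ^ m) v ≠ 0 := by
        induction m with
        | zero => simpa using hv
        | succ m ih =>
          rw [pow_succ', mul_apply_eq_comp]
          exact fun h0 => h1 ⟨_, ih, h0⟩
      exact fun h0 => hm (by simp [h0])
  · push Not at h1 h2
    -- A partial isometry kills `B* B x - x`, so an injective one is an isometry.
    have inj : ∀ B : H →L[ℂ] H, (∀ x, x ≠ 0 → B x ≠ 0) → B * star B * B = B → star B * B = 1 := by
      intro B hB h
      refine ContinuousLinearMap.ext fun x => ?_
      by_contra hne
      refine hB _ (sub_ne_zero.mpr hne) ?_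
      have h' := congrArg (fun X : H →L[ℂ] H => X x) h
      simp only [mul_apply_eq_comp] at h'
      simp [map_sub, h']
    have hppi := hA.powerPartialIsometry i
    refine Or.inl (Unitary.mem_iff.mpr ⟨inj _ h2 hppi.isPartialIsometry, ?_⟩)
    simpa using inj _ h1 hppi.adjoint.isPartialIsometry

end Family

/-! ### Ordered monomials -/

section Monomial

variable {α : Type*} {H : Type*} [NormedAddCommGroup H] [InnerProductSpace ℂ H] [CompleteSpace H]

/-- The product of the powers `B a ^ k a` in the order of the list `l`. -/
def monomial (B : α → H →L[ℂ] H) (l : List α) (k : α → ℕ) : H →L[ℂ] H :=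
  (l.map fun a => B a ^ k a).prod

/-- The vectors annihilated by all the adjoints. -/
def vacuum (B : α → H →L[ℂ] H) : Submodule ℂ H :=
  ⨅ a, LinearMap.ker ((star (B a) : H →L[ℂ] H) : H →ₗ[ℂ] H)

variable {B : α → H →L[ℂ] H} {l : List α} {k : α → ℕ}

theorem mem_vacuum {x : H} : x ∈ vacuum B ↔ ∀ a, star (B a) x = 0 := by
  simp [vacuum]

theorem isClosed_vacuum : IsClosed (vacuum B : Set H) := by
  have h : (vacuum B : Set H) = ⋂ a, {x | star (B a) x = 0} := by
    ext x
    simp [mem_vacuum]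
  rw [h]
  exact isClosed_iInter fun a => isClosed_eq (star (B a)).continuous continuous_const

@[simp]
theorem monomial_nil : monomial B [] k = 1 := rfl

@[simp]
theorem monomial_cons (a : α) : monomial B (a :: l) k = B a ^ k a * monomial B l k := by
  simp [monomial]

theorem monomial_append (l' : List α) :
    monomial B (l ++ l') k = monomial B l k * monomial B l' k := by
  simp [monomial]

theorem monomial_congr {k' : α → ℕ} (h : ∀ a ∈ l, k a = k' a) :
    monomial B l k = monomial B l k' := by
  unfold monomial
  congr 1
  exact List.map_congr_left fun a ha => by rw [h a ha]

theorem monomial_zero : monomial B l 0 = 1 := by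
  induction l with
  | nil => rfl
  | cons a l ih => rw [monomial_cons, ih]; simp

theorem monomial_eq_zero {a : α} (ha : a ∈ l) (h : B a ^ k a = 0) : monomial B l k = 0 :=
  List.prod_eq_zero (List.mem_map.mpr ⟨a, ha, h⟩)

/-- The source of every diagonal operator: the scalar collected depends on the exponents only. -/
theorem mul_monomial_of_twist {X : H →L[ℂ] H} {d : α → unitary ℂ}
    (h : ∀ a ∈ l, X * B a = (d a : ℂ) • (B a * X)) :
    X * monomial B l k = (((l.map fun a => d a ^ k a).prod : unitary ℂ) : ℂ) •
      (monomial B l k * X) := by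
  induction l with
  | nil => simp
  | cons a l ih =>
    rw [monomial_cons, ← mul_assoc, mul_pow_of_twist (h a (by simp)), smul_mul_assoc, mul_assoc,
      ih fun b hb => h b (by simp [hb])]
    simp [smul_smul, mul_assoc]

variable {c : α → α → unitary ℂ}

/-- This makes it possible to peel off the first factor of a monomial: what remains still lies in
the kernel of that factor's adjoint. -/
theorem ScalarTwisted.star_monomial_apply (hB : ScalarTwisted c B) {j : α} (hj : j ∉ l) {x : H}
    (hx : star (B j) x = 0) :
    star (B j) (monomial B l k x) = 0 := by
  have h := mul_monomial_of_twist (B := B) (l := l) (k := k) (X := star (B j)) (d := c j)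
    fun a ha => hB.star_mul j a fun h => hj (h ▸ ha)
  have h' := congrArg (fun X : H →L[ℂ] H => X x) h
  simpa [hx] using h'

theorem ScalarTwisted.mul_monomial (hB : ScalarTwisted c B) [DecidableEq α] {l₁ l₂ : List α}
    {j : α} (h₁ : j ∉ l₁) (h₂ : j ∉ l₂) :
    B j * monomial B (l₁ ++ j :: l₂) k =
      (((l₁.map fun a => c a j ^ k a).prod : unitary ℂ) : ℂ) •
        monomial B (l₁ ++ j :: l₂) (Function.update k j (k j + 1)) := by
  have h : ∀ l' : List α, j ∉ l' →
      monomial B l' (Function.update k j (k j + 1)) = monomial B l' k := fun l' hl' =>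
    monomial_congr fun a ha => Function.update_of_ne (fun h => hl' (by rwa [h] at ha)) _ _
  rw [monomial_append, monomial_append, monomial_cons, monomial_cons, h _ h₁, h _ h₂, ← mul_assoc,
    mul_monomial_of_twist (d := fun a => c a j) fun a ha => hB.mul j a fun h => h₁ (h ▸ ha),
    smul_mul_assoc, Function.update_self, pow_succ']
  simp only [mul_assoc]

-- Factors are peeled off from the left by `HasKind.inner_pow_pow`. Only `k` must be admissible;
-- `k'` is arbitrary, so that exponents raised beyond the end of a `J_p` are covered as well.
open Classical in
theorem ScalarTwisted.inner_monomial (hB : ScalarTwisted c B) {κ : α → Kind}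
    (hκ : ∀ a, HasKind (κ a) (B a))
    (hl : l.Nodup) {x y : H} (hx : x ∈ vacuum B) (hy : y ∈ vacuum B)
    (hk : ∀ a ∈ l, k a ∈ Set.range (κ a).val) (k' : α → ℕ) :
    inner ℂ (monomial B l k x) (monomial B l k' y)
      = if ∀ a ∈ l, k a = k' a then inner ℂ x y else 0 := by
  induction l with
  | nil => simp
  | cons a l ih =>
    rw [List.nodup_cons] at hl
    rw [monomial_cons, monomial_cons, mul_apply_eq_comp, mul_apply_eq_comp,
      (hκ a).inner_pow_pow (hB.powerPartialIsometry a)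
        (hB.star_monomial_apply hl.1 (mem_vacuum.mp hx a))
        (hB.star_monomial_apply hl.1 (mem_vacuum.mp hy a)) (hk a (by simp)),
      ih hl.2 fun b hb => hk b (by simp [hb])]
    simp only [List.forall_mem_cons]
    by_cases h : k a = k' a <;> simp [h]

/-- Given `x` killed by the other adjoints, purity of `B j` makes some `(1 - B j B j*) (B j*) ^ m x`
non-zero. It lies in `ker B j*`, and the other adjoints still kill it: they commute with `1 - B j B
j*` and pass `(B j*) ^ m` up to a scalar. -/
theorem ScalarTwisted.exists_vacuum (hB : ScalarTwisted c B) [Nontrivial H] {κ : α → Kind}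
    (hκ : ∀ a, HasKind (κ a) (B a)) (l : List α) (hl : l.Nodup) :
    ∃ x : H, x ≠ 0 ∧ ∀ a ∈ l, star (B a) x = 0 := by
  induction l with
  | nil => simpa using exists_ne (0 : H)
  | cons j l ih =>
    rw [List.nodup_cons] at hl
    obtain ⟨x, hx0, hx⟩ := ih hl.2
    have hex : ∃ m : ℕ, (1 - B j * star (B j)) ((star (B j) ^ m) x) ≠ 0 := by
      by_contra! h
      exact hx0 ((hκ j).eq_zero x h)
    obtain ⟨m, hm⟩ := hex
    refine ⟨_, hm, ?_⟩
    rw [List.forall_mem_cons]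
    refine ⟨?_, fun a ha => ?_⟩
    · have h1 : star (B j) * (1 - B j * star (B j)) = 0 := by
        have h := (hB.powerPartialIsometry j).adjoint.isPartialIsometry
        rw [star_star] at h
        rw [mul_sub, mul_one, ← mul_assoc, h, sub_self]
      exact congrArg (fun X : H →L[ℂ] H => X ((star (B j) ^ m) x)) h1
    · have haj : a ≠ j := fun h => hl.1 (h ▸ ha)
      have h1 : star (B a) * (1 - B j * star (B j)) = (1 - B j * star (B j)) * star (B a) := by
        rw [mul_sub, ← mul_assoc, hB.star_mul a j haj, smul_mul_assoc, mul_assoc,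
          hB.star_mul_star haj, mul_smul_comm, smul_smul, hB.symm a j haj]
        rw [← Submonoid.coe_mul]
        simp [sub_mul, mul_assoc]
      have h2 := mul_pow_of_twist (hB.star_mul_star haj) m
      have h3 : star (B a) * ((1 - B j * star (B j)) * star (B j) ^ m)
          = ((c j a : ℂ) ^ m) • ((1 - B j * star (B j)) * star (B j) ^ m * star (B a)) := by
        rw [← mul_assoc, h1, mul_assoc, h2, mul_smul_comm, mul_assoc]
      have h4 := congrArg (fun X : H →L[ℂ] H => X x) h3
      simpa [hx a ha] using h4

theorem ScalarTwisted.comp {β : Type*} (hB : ScalarTwisted c B) {f : β → α}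
    (hf : Function.Injective f) : ScalarTwisted (fun i j => c (f i) (f j)) (B ∘ f) where
  symm _ _ h := hB.symm _ _ (hf.ne h)
  powerPartialIsometry _ := hB.powerPartialIsometry _
  star_mul _ _ h := hB.star_mul _ _ (hf.ne h)
  mul _ _ h := hB.mul _ _ (hf.ne h)

end Monomial

/-! ### The vacuum as a reducing subspace, and totality of the monomials -/

section Reducing

variable {ι : Type*} {H : Type*} [NormedAddCommGroup H] [InnerProductSpace ℂ H] [CompleteSpace H]
variable {c : ι → ι → unitary ℂ} {A : ι → H →L[ℂ] H} {s : Finset ι}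
  {κ : {i : ι // i ∉ s} → Kind} {l : List {i : ι // i ∉ s}}

/-- The vacuum is invariant under the remaining members of a twisted family. -/
theorem ScalarTwisted.vacuum_invariant (hA : ScalarTwisted c A) {j : ι} (hj : j ∈ s) {x : H}
    (hx : x ∈ vacuum fun a : {i : ι // i ∉ s} => A a) :
    A j x ∈ vacuum (fun a : {i : ι // i ∉ s} => A a) ∧
      star (A j) x ∈ vacuum fun a : {i : ι // i ∉ s} => A a := by
  rw [mem_vacuum] at hx
  have h : ∀ a : {i : ι // i ∉ s}, (a : ι) ≠ j := fun a h => a.2 (h ▸ hj)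
  refine ⟨mem_vacuum.mpr fun a => ?_, mem_vacuum.mpr fun a => ?_⟩
  · have h' := congrArg (fun X : H →L[ℂ] H => X x) (hA.star_mul a j (h a))
    simpa [hx a] using h'
  · have h' := congrArg (fun X : H →L[ℂ] H => X x) (hA.star_mul_star (h a))
    simpa [hx a] using h'

/-- Monomials applied to a non-zero invariant subspace of the vacuum are total. -/
theorem ScalarTwisted.dense_span_monomial (hA : ScalarTwisted c A) (hirr : IsIrreducibleFamily A)
    (hκ : ∀ a, HasKind (κ a) (A a)) (hl : l.Nodup) (hmem : ∀ a, a ∈ l) {M : Submodule ℂ H}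
    (hM : M ≠ ⊥) (hMv : M ≤ vacuum fun a : {i : ι // i ∉ s} => A a)
    (hinv : ∀ j ∈ s, ∀ x ∈ M, A j x ∈ M ∧ star (A j) x ∈ M) :
    Dense (Submodule.span ℂ {z | ∃ k, ∃ y ∈ M,
      z = monomial (fun a : {i : ι // i ∉ s} => A a) l k y} : Set H) := by
  classical
  set S : Set H := {z | ∃ k, ∃ y ∈ M, z = monomial (fun a : {i : ι // i ∉ s} => A a) l k y}
    with hS
  have hB : ScalarTwisted (fun i j : {i : ι // i ∉ s} => c i j)
    (fun a : {i : ι // i ∉ s} => A a) := hA.comp Subtype.val_injective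
  obtain ⟨x, hx, hx0⟩ := Submodule.exists_mem_ne_zero_of_ne_bot hM
  refine hirr.dense_span ⟨x, ⟨0, x, hx, by simp [monomial_zero]⟩, hx0⟩ ?_
  rintro j _ ⟨k, y, hy, rfl⟩
  by_cases hj : j ∈ s
  · have h : ∀ a : {i : ι // i ∉ s}, j ≠ a := fun a h => a.2 (h ▸ hj)
    have h1 := mul_monomial_of_twist (B := fun a : {i : ι // i ∉ s} => A a) (l := l) (k := k)
      (X := A j) (d := fun a => c a j) fun a _ => hA.mul j a (h a)
    have h2 := mul_monomial_of_twist (B := fun a : {i : ι // i ∉ s} => A a) (l := l) (k := k)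
      (X := star (A j)) (d := fun a => c j a) fun a _ => hA.star_mul j a (h a)
    rw [← mul_apply_eq_comp, ← mul_apply_eq_comp, h1, h2]
    exact ⟨Submodule.smul_mem _ _ (Submodule.subset_span ⟨k, _, (hinv j hj y hy).1, rfl⟩),
      Submodule.smul_mem _ _ (Submodule.subset_span ⟨k, _, (hinv j hj y hy).2, rfl⟩)⟩
  · obtain ⟨l₁, l₂, rfl⟩ := List.append_of_mem (hmem ⟨j, hj⟩)
    have hn := List.nodup_middle.mp hl
    rw [List.nodup_cons, List.mem_append, not_or] at hn
    obtain ⟨⟨h₁, h₂⟩, -⟩ := hn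
    constructor
    · have h := hB.mul_monomial (k := k) h₁ h₂
      have h' := congrArg (fun X : H →L[ℂ] H => X y) h
      simp only [mul_apply_eq_comp] at h'
      rw [h']
      exact Submodule.smul_mem _ _ (Submodule.subset_span ⟨_, y, hy, rfl⟩)
    · set z := monomial (fun a : {i : ι // i ∉ s} => A a) l₂ k y with hz
      have hz0 : star (A j) z = 0 :=
        hB.star_monomial_apply (j := ⟨j, hj⟩) h₂ (mem_vacuum.mp (hMv hy) ⟨j, hj⟩)
      have h1 := mul_monomial_of_twist (B := fun a : {i : ι // i ∉ s} => A a) (l := l₁) (k := k)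
        (X := star (A j)) (d := fun a : {i : ι // i ∉ s} => c j a)
        fun a ha => hB.star_mul ⟨j, hj⟩ a fun h => h₁ (h ▸ ha)
      have h2 : star (A j) (monomial (fun a : {i : ι // i ∉ s} => A a) (l₁ ++ ⟨j, hj⟩ :: l₂) k y)
          = (((l₁.map fun a : {i : ι // i ∉ s} => c j a ^ k a).prod : unitary ℂ) : ℂ) •
            monomial (fun a : {i : ι // i ∉ s} => A a) l₁ k
              (star (A j) ((A j ^ k ⟨j, hj⟩) z)) := by
        rw [monomial_append, mul_apply_eq_comp, ← mul_apply_eq_comp (star (A j)), h1,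
          monomial_cons]
        rfl
      rw [h2]
      refine Submodule.smul_mem _ _ ?_
      -- The adjoint has reached its own factor. It kills the vector at exponent zero and lowers a
      -- positive admissible exponent; an inadmissible power is already zero.
      rcases hm : k ⟨j, hj⟩ with _ | m
      · simp [hz0]
      · by_cases hv : m + 1 ∈ Set.range (κ ⟨j, hj⟩).val
        · rw [(hκ ⟨j, hj⟩).star_pow_succ_apply (hA.powerPartialIsometry j) hz0 hv]
          refine Submodule.subset_span ⟨Function.update k ⟨j, hj⟩ m, y, hy, ?_⟩
          have h : ∀ l' : List {i : ι // i ∉ s}, ⟨j, hj⟩ ∉ l' →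
              monomial (fun a : {i : ι // i ∉ s} => A a) l' (Function.update k ⟨j, hj⟩ m)
                = monomial (fun a : {i : ι // i ∉ s} => A a) l' k := fun l' hl' =>
            monomial_congr fun a ha =>
              Function.update_of_ne (fun h => hl' (by rwa [h] at ha)) _ _
          rw [monomial_append, monomial_cons, h _ h₁, h _ h₂, Function.update_self]
          rfl
        · have h0 := (hκ ⟨j, hj⟩).pow_eq_zero _ hv
          simp only at h0
          simp [h0]

end Reducing

/-! ### Scalar unitaries and diagonal operators -/

section ScalarDiag

variable {E : Type*} [NormedAddCommGroup E] [InnerProductSpace ℂ E] [CompleteSpace E]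

/-- A scalar of modulus one as a unitary operator. -/
def scalarUnitary (E : Type*) [NormedAddCommGroup E] [InnerProductSpace ℂ E] [CompleteSpace E] :
    unitary ℂ →⋆* unitary (E →L[ℂ] E) :=
  Unitary.map
    { (algebraMap ℂ (E →L[ℂ] E) : ℂ →* (E →L[ℂ] E)) with
      map_star' := algebraMap_star_comm }

theorem coe_scalarUnitary (z : unitary ℂ) :
    (scalarUnitary E z : E →L[ℂ] E) = algebraMap ℂ (E →L[ℂ] E) z := rfl

theorem scalarUnitary_apply (z : unitary ℂ) (x : E) :
    (scalarUnitary E z : E →L[ℂ] E) x = (z : ℂ) • x := by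
  rw [coe_scalarUnitary, Algebra.algebraMap_eq_smul_one]
  simp

variable {K : Type*}

/-- Diagonal operators with scalar entries of modulus one. -/
def scalarDiag (K E : Type*) [NormedAddCommGroup E] [InnerProductSpace ℂ E] [CompleteSpace E] :
    (K → unitary ℂ) →* (L2 K E →L[ℂ] L2 K E) where
  toFun σ := diag fun k => scalarUnitary E (σ k)
  map_one' := by
    ext f k
    rw [diag_apply, scalarUnitary_apply]
    simp
  map_mul' σ τ := by
    ext f k
    rw [mul_apply_eq_comp, diag_apply, diag_apply, diag_apply]
    simp only [scalarUnitary_apply, Pi.mul_apply, Submonoid.coe_mul, mul_smul]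

theorem scalarDiag_apply (σ : K → unitary ℂ) (f : L2 K E) (k : K) :
    scalarDiag K E σ f k = (σ k : ℂ) • f k := by
  change diag _ f k = _
  rw [diag_apply, scalarUnitary_apply]

theorem star_scalarDiag (σ : K → unitary ℂ) :
    star (scalarDiag K E σ) = scalarDiag K E (star σ) := by
  refine (ContinuousLinearMap.eq_adjoint_iff _ _).mpr (fun f g => ?_) |>.symm
  rw [lp.inner_eq_tsum, lp.inner_eq_tsum]
  refine tsum_congr fun k => ?_
  rw [scalarDiag_apply, scalarDiag_apply, inner_smul_left, inner_smul_right]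
  simp

theorem L2.ext_single [DecidableEq K] {F : Type*} [NormedAddCommGroup F] [NormedSpace ℂ F]
    {X Y : L2 K E →L[ℂ] F} (h : ∀ k η, X (lp.single 2 k η) = Y (lp.single 2 k η)) : X = Y := by
  ext f
  have hf := lp.hasSum_single (by norm_num) f
  have hX := hf.mapL X
  have hY := hf.mapL Y
  simp only [h] at hX
  exact hX.unique hY

theorem L2.inner_single_left [DecidableEq K] (k : K) (η : E) (f : L2 K E) :
    inner ℂ (lp.single 2 k η : L2 K E) f = inner ℂ η (f k) :=
  lp.inner_single_left k η f

theorem L2.ext_inner_single [DecidableEq K] {f g : L2 K E}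
    (h : ∀ k η, inner ℂ (lp.single 2 k η : L2 K E) f = inner ℂ (lp.single 2 k η : L2 K E) g) :
    f = g := by
  refine lp.ext (funext fun k => ext_inner_left ℂ fun η => ?_)
  have h' := h k η
  rwa [L2.inner_single_left, L2.inner_single_left] at h'

end ScalarDiag

/-! ### The twists of the model operators -/

section Twists

variable {n : ℕ} {Φu : Finset (Fin n)} (κ : {i : Fin n // i ∉ Φu} → Kind)
variable {E : Type*} [NormedAddCommGroup E] [InnerProductSpace ℂ E] [CompleteSpace E]
variable (c : Fin n → Fin n → unitary ℂ)

/-- The scalar by which the factor `i` twists the operator with index `j`. -/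
def twistScalar (i : {i : Fin n // i ∉ Φu}) (j : Fin n) : unitary ℂ :=
  match κ i with
  | .shift => c i j
  | .backward => c j i
  | .truncated _ => c i j

theorem twistAt_scalarUnitary (i : {i : Fin n // i ∉ Φu}) (j : Fin n) :
    twistAt κ (fun i j => scalarUnitary E (c i j)) i j
      = scalarDiag _ E fun q => twistScalar κ c i j ^ (κ i).val (q i) := by
  have h : ∀ z : unitary ℂ, diagAt κ i (scalarUnitary E z)
      = scalarDiag _ E fun q => z ^ (κ i).val (q i) := by
    intro z
    change diag _ = diag _
    simp only [map_pow]
  unfold twistAt twistScalar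
  split <;> rw [h]

-- For scalar twists the ordered product is one diagonal operator, so its order is immaterial.
open Classical in
theorem twistProd_scalarUnitary (P : {i : Fin n // i ∉ Φu} → Prop) (j : Fin n) :
    twistProd κ (fun i j => scalarUnitary E (c i j)) P j
      = scalarDiag _ E fun q =>
          ∏ i with P i, twistScalar κ c i j ^ (κ i).val (q i) := by
  have h : ∀ i : Fin n, (if h : i ∉ Φu then
        (if P ⟨i, h⟩ then twistAt κ (fun i j => scalarUnitary E (c i j)) ⟨i, h⟩ j else 1) else 1)
      = scalarDiag _ E (if h : i ∉ Φu then
        (if P ⟨i, h⟩ then (fun q => twistScalar κ c ⟨i, h⟩ j ^ (κ ⟨i, h⟩).val (q ⟨i, h⟩))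
          else 1) else 1) := by
    intro i
    split_ifs
    exacts [(map_one _).symm, twistAt_scalarUnitary κ c _ j, (map_one _).symm]
  unfold twistProd
  simp only [h]
  rw [← Function.comp_def (scalarDiag _ E), ← List.map_ofFn, ← map_list_prod, List.prod_ofFn]
  congr 1
  refine (Finset.prod_congr_set {i | i ∉ Φu} _ (fun i : {i : Fin n // i ∉ Φu} =>
    if P i then (fun q : ∀ i, (κ i).Idx => twistScalar κ c i j ^ (κ i).val (q i))
      else (1 : (∀ i, (κ i).Idx) → unitary ℂ))
    (fun i hi => dif_pos hi) (fun i hi => dif_neg hi)).trans ?_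
  funext q
  rw [Finset.prod_apply, Finset.prod_filter]
  exact Finset.prod_congr rfl fun i _ => by split_ifs <;> rfl

theorem coreAt_of_ne_backward {j : {i : Fin n // i ∉ Φu}} (h : κ j ≠ .backward) :
    coreAt (E := E) κ j = forwardAt κ j := by
  unfold coreAt
  split <;> simp_all

theorem coreAt_of_eq_backward {j : {i : Fin n // i ∉ Φu}} (h : κ j = .backward) :
    coreAt (E := E) κ j = star (forwardAt (E := E) κ j) := by
  unfold coreAt
  split <;> simp_all [ContinuousLinearMap.star_eq_adjoint]

/-- The hypothesis says that the symbol does not depend on the coordinate `j`, the only one that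
`forwardAt κ j` moves. -/
theorem commute_scalarDiag_forwardAt {j : {i : Fin n // i ∉ Φu}}
    {σ : (∀ i, (κ i).Idx) → unitary ℂ} (h : ∀ q m, σ (Function.update q j m) = σ q) :
    Commute (scalarDiag _ E σ) (forwardAt κ j) := by
  refine ContinuousLinearMap.ext fun f => lp.ext (funext fun q => ?_)
  rw [mul_apply_eq_comp, mul_apply_eq_comp, scalarDiag_apply, forwardAt, pull_apply, pull_apply,
    scalarDiag_apply, h, smul_ite, smul_zero]

/-- There is a list of the non-unitary indices in the order of the tensor factors. -/
theorem exists_list_precedes : ∃ l : List {i : Fin n // i ∉ Φu},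
    l.Nodup ∧ (∀ a, a ∈ l) ∧ l.Pairwise (Precedes κ) := by
  classical
  let f : {i : Fin n // i ∉ Φu} → ℕ ×ₗ Fin n := fun i => toLex ((κ i).rank, i.1)
  have hf : Function.Injective f := fun i j h => by
    have h' := congrArg (fun x => (ofLex x).2) h
    exact Subtype.ext h'
  let r : {i : Fin n // i ∉ Φu} → {i : Fin n // i ∉ Φu} → Prop := fun i j => f i ≤ f j
  have : IsTrans _ r := ⟨fun _ _ _ => le_trans⟩
  have : Std.Antisymm r := ⟨fun _ _ h h' => hf (le_antisymm h h')⟩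
  have : Std.Total r := ⟨fun _ _ => le_total _ _⟩
  refine ⟨(Finset.univ : Finset {i : Fin n // i ∉ Φu}).sort r, Finset.sort_nodup _ _,
    fun a => (Finset.mem_sort _).mpr (Finset.mem_univ a), ?_⟩
  refine ((Finset.pairwise_sort _ _).and (Finset.sort_nodup _ _)).imp fun {a b} h => ?_
  have h1 : f a ≤ f b := h.1
  have h2 : f a < f b := lt_of_le_of_ne h1 (hf.ne h.2)
  rcases Prod.Lex.lt_iff.mp h2 with h3 | h3
  · exact Or.inl h3
  · exact Or.inr h3

theorem Precedes.irrefl (i : {i : Fin n // i ∉ Φu}) : ¬ Precedes κ i i := by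
  unfold Precedes
  omega

theorem Precedes.asymm {i j : {i : Fin n // i ∉ Φu}} (h : Precedes κ i j) : ¬ Precedes κ j i := by
  unfold Precedes at h ⊢
  omega

-- In a list sorted by `Precedes`, the entries before `j` are exactly its predecessors.
open Classical in
theorem prod_precedes {l₁ l₂ : List {i : Fin n // i ∉ Φu}} {j : {i : Fin n // i ∉ Φu}}
    (hl : (l₁ ++ j :: l₂).Nodup) (hmem : ∀ a, a ∈ l₁ ++ j :: l₂)
    (hp : (l₁ ++ j :: l₂).Pairwise (Precedes κ)) {M : Type*} [CommMonoid M]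
    (f : {i : Fin n // i ∉ Φu} → M) :
    (l₁.map f).prod = ∏ i with Precedes κ i j, f i := by
  rw [← List.prod_toFinset f (List.nodup_append.mp hl).1]
  refine Finset.prod_congr ?_ fun _ _ => rfl
  ext a
  rw [List.mem_toFinset, Finset.mem_filter_univ]
  rw [List.pairwise_append, List.pairwise_cons] at hp
  refine ⟨fun h => hp.2.2 a h j (by simp), fun h => ?_⟩
  rcases List.mem_append.mp (hmem a) with h' | h'
  · exact h'
  · rcases List.mem_cons.mp h' with rfl | h'
    · exact absurd h h.asymm
    · exact absurd h (hp.2.1.1 a h').asymm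

end Twists

/-! ### Unitaries and adjoints -/

section Restrict

variable {H : Type*} [NormedAddCommGroup H] [InnerProductSpace ℂ H] [CompleteSpace H]

/-- A unitary restricts to a unitary on a reducing subspace. -/
theorem exists_restrict_unitary {B : H →L[ℂ] H} (hB : B ∈ unitary (H →L[ℂ] H))
    {N : Submodule ℂ H} [CompleteSpace N] (h : ∀ x ∈ N, B x ∈ N ∧ star B x ∈ N) :
    ∃ T : unitary (N →L[ℂ] N), ∀ x : N, ((T : N →L[ℂ] N) x : H) = B x ∧
      ((star T : N →L[ℂ] N) x : H) = star B x := by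
  let R : N →L[ℂ] N := (B.comp N.subtypeL).codRestrict N fun x => (h x x.2).1
  let R' : N →L[ℂ] N := ((star B).comp N.subtypeL).codRestrict N fun x => (h x x.2).2
  have hR : star R = R' := by
    refine (ContinuousLinearMap.eq_adjoint_iff _ _).mpr (fun x y => ?_) |>.symm
    exact ContinuousLinearMap.adjoint_inner_left B (y : H) (x : H)
  have h1 : R' * R = 1 := by
    ext x
    exact congrArg (fun X : H →L[ℂ] H => X x) hB.1
  have h2 : R * R' = 1 := by
    ext x
    exact congrArg (fun X : H →L[ℂ] H => X x) hB.2
  refine ⟨⟨R, Unitary.mem_iff.mpr ⟨by rw [hR, h1], by rw [hR, h2]⟩⟩, fun x => ⟨rfl, ?_⟩⟩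
  change ((star R : N →L[ℂ] N) x : H) = _
  rw [hR]
  rfl

theorem star_apply_of_intertwines {L : Type*} [NormedAddCommGroup L] [InnerProductSpace ℂ L]
    [CompleteSpace L] (B : L ≃ₗᵢ[ℂ] H) {X : H →L[ℂ] H} {M : L →L[ℂ] L}
    (h : ∀ f, X (B f) = B (M f)) (f : L) : star X (B f) = B (star M f) := by
  refine ext_inner_left ℂ fun w => ?_
  obtain ⟨g, rfl⟩ := B.surjective w
  rw [B.inner_map_map, ContinuousLinearMap.star_eq_adjoint, ContinuousLinearMap.star_eq_adjoint,
    ContinuousLinearMap.adjoint_inner_right, ContinuousLinearMap.adjoint_inner_right, h,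
    B.inner_map_map]

end Restrict

/-! ### The intertwining unitary -/

section Intertwiner

variable {n : ℕ} {Φu : Finset (Fin n)} {κ : {i : Fin n // i ∉ Φu} → Kind}
variable {H : Type*} [NormedAddCommGroup H] [InnerProductSpace ℂ H] [CompleteSpace H]
variable {c : Fin n → Fin n → unitary ℂ} {A : Fin n → H →L[ℂ] H}
variable {l : List {i : Fin n // i ∉ Φu}}

/-- The exponents belonging to a basis index. -/
def exponents (κ : {i : Fin n // i ∉ Φu} → Kind) (q : ∀ i, (κ i).Idx) :
    {i : Fin n // i ∉ Φu} → ℕ := fun i => (κ i).val (q i)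

theorem exponents_injective : Function.Injective (exponents κ) := fun _ _ h =>
  funext fun i => (κ i).val_injective (congrFun h i)

theorem exponents_mem_range (q : ∀ i, (κ i).Idx) (i : {i : Fin n // i ∉ Φu}) :
    exponents κ q i ∈ Set.range (κ i).val := ⟨q i, rfl⟩

/-- The subspace annihilated by the adjoints of the members with index outside `Φu`. -/
abbrev vacuumOff (Φu : Finset (Fin n)) (A : Fin n → H →L[ℂ] H) : Submodule ℂ H :=
  vacuum fun a : {i : Fin n // i ∉ Φu} => A a

/-- The ordered monomials in the members with index outside `Φu`. -/
abbrev monomialOff (A : Fin n → H →L[ℂ] H) (l : List {i : Fin n // i ∉ Φu})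
    (k : {i : Fin n // i ∉ Φu} → ℕ) : H →L[ℂ] H :=
  monomial (fun a : {i : Fin n // i ∉ Φu} => A a) l k

theorem ScalarTwisted.off (hA : ScalarTwisted c A) (Φu : Finset (Fin n)) :
    ScalarTwisted (fun i j : {i : Fin n // i ∉ Φu} => c i j)
      (fun a : {i : Fin n // i ∉ Φu} => A a) := hA.comp Subtype.val_injective

open Classical in
theorem ScalarTwisted.inner_monomialOff (hA : ScalarTwisted c A) (hκ : ∀ a, HasKind (κ a) (A a))
    (hl : l.Nodup) (hmem : ∀ a, a ∈ l) {x y : H} (hx : x ∈ vacuumOff Φu A)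
    (hy : y ∈ vacuumOff Φu A) (q : ∀ i, (κ i).Idx) (k : {i : Fin n // i ∉ Φu} → ℕ) :
    inner ℂ (monomialOff A l (exponents κ q) x) (monomialOff A l k y)
      = if exponents κ q = k then inner ℂ x y else 0 := by
  refine ((hA.off Φu).inner_monomial hκ hl hx hy (fun a _ => exponents_mem_range q a) k).trans ?_
  by_cases h : exponents κ q = k
  · rw [if_pos h, if_pos fun a _ => congrFun h a]
  · rw [if_neg h, if_neg fun h' => h (funext fun a => h' a (hmem a))]

variable (hA : ScalarTwisted c A) (hκ : ∀ a, HasKind (κ a) (A a)) (hl : l.Nodup)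
  (hmem : ∀ a, a ∈ l)

/-- The isometric embedding of the vacuum by a monomial. -/
def monomialIsometry (hA : ScalarTwisted c A) (hκ : ∀ a, HasKind (κ a) (A a)) (hl : l.Nodup)
    (hmem : ∀ a, a ∈ l) (q : ∀ i, (κ i).Idx) : vacuumOff Φu A →ₗᵢ[ℂ] H where
  toLinearMap := (monomialOff A l (exponents κ q) : H →ₗ[ℂ] H) ∘ₗ (vacuumOff Φu A).subtype
  norm_map' x := by
    have h := hA.inner_monomialOff hκ hl hmem x.2 x.2 q (exponents κ q)
    rw [if_pos rfl, inner_self_eq_norm_sq_to_K, inner_self_eq_norm_sq_to_K] at h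
    have h' : ‖monomialOff A l (exponents κ q) x‖ ^ 2 = ‖(x : H)‖ ^ 2 := by exact_mod_cast h
    exact (sq_eq_sq₀ (norm_nonneg _) (norm_nonneg _)).mp h'

theorem monomialIsometry_apply (q : ∀ i, (κ i).Idx) (x : vacuumOff Φu A) :
    monomialIsometry hA hκ hl hmem q x = monomialOff A l (exponents κ q) x := rfl

instance : CompleteSpace (vacuumOff Φu A) := isClosed_vacuum.completeSpace_coe

theorem vacuumOff_ne_bot [Nontrivial H] (hA : ScalarTwisted c A)
    (hκ : ∀ a, HasKind (κ a) (A a)) (hl : l.Nodup) (hmem : ∀ a, a ∈ l) : vacuumOff Φu A ≠ ⊥ := by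
  obtain ⟨x, hx0, hx⟩ := (hA.off Φu).exists_vacuum hκ l hl
  intro h
  have hx' : x ∈ vacuumOff Φu A := mem_vacuum.mpr fun a => hx a (hmem a)
  rw [h] at hx'
  exact hx0 ((Submodule.mem_bot ℂ).mp hx')

/-- Distinct basis indices have distinct exponents, whence orthogonality. Totality follows from
`dense_span_monomial`, since monomials with an inadmissible exponent vanish. -/
theorem isHilbertSum_monomialIsometry (hirr : IsIrreducibleFamily A) :
    IsHilbertSum ℂ (fun _ : ∀ i, (κ i).Idx => vacuumOff Φu A)
      (monomialIsometry hA hκ hl hmem) := by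
  classical
  have := hirr.1
  refine IsHilbertSum.mk (fun q q' hq x y => ?_) ?_
  · rw [monomialIsometry_apply, monomialIsometry_apply,
      hA.inner_monomialOff hκ hl hmem x.2 y.2, if_neg (exponents_injective.ne hq)]
  · have hd := hA.dense_span_monomial hirr hκ hl hmem (vacuumOff_ne_bot hA hκ hl hmem) le_rfl
      fun j hj x hx => hA.vacuum_invariant hj hx
    rw [Submodule.dense_iff_topologicalClosure_eq_top] at hd
    rw [← hd]
    refine Submodule.topologicalClosure_mono (Submodule.span_le.mpr ?_)
    rintro _ ⟨k, y, hy, rfl⟩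
    by_cases hk : ∀ a, k a ∈ Set.range (κ a).val
    · choose q hq using hk
      have hkq : k = exponents κ q := funext fun a => (hq a).symm
      rw [hkq]
      exact Submodule.mem_iSup_of_mem q ⟨⟨y, hy⟩, rfl⟩
    · push Not at hk
      obtain ⟨a, ha⟩ := hk
      rw [monomial_eq_zero (hmem a) ((hκ a).pow_eq_zero _ ha)]
      exact Submodule.zero_mem _

/-- The unitary from the model space. -/
def fromModel (hirr : IsIrreducibleFamily A) : Model κ (vacuumOff Φu A) ≃ₗᵢ[ℂ] H :=
  (isHilbertSum_monomialIsometry hA hκ hl hmem hirr).linearIsometryEquiv.symm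

variable (hirr : IsIrreducibleFamily A)

theorem fromModel_single [DecidableEq (∀ i, (κ i).Idx)] (q : ∀ i, (κ i).Idx)
    (x : vacuumOff Φu A) :
    fromModel hA hκ hl hmem hirr (lp.single 2 q x) = monomialOff A l (exponents κ q) x :=
  (isHilbertSum_monomialIsometry hA hκ hl hmem hirr).linearIsometryEquiv_symm_apply_single x

-- Both sides have the same matrix coefficients between basis tensors: `A j` raises the exponent of
-- its factor after passing the factors listed before it.
open Classical in
theorem fromModel_forward (hp : l.Pairwise (Precedes κ)) (j : {i : Fin n // i ∉ Φu})
    (f : Model κ (vacuumOff Φu A)) :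
    A j (fromModel hA hκ hl hmem hirr f) = fromModel hA hκ hl hmem hirr
      (scalarDiag _ _ (fun q => ∏ i with Precedes κ i j, c i j ^ (κ i).val (q i))
        (forwardAt κ j f)) := by
  obtain ⟨l₁, l₂, rfl⟩ := List.append_of_mem (hmem j)
  have hn := List.nodup_middle.mp hl
  rw [List.nodup_cons, List.mem_append, not_or] at hn
  obtain ⟨⟨h₁, h₂⟩, -⟩ := hn
  set B := fromModel hA hκ hl hmem hirr with hB
  set σ : (∀ i, (κ i).Idx) → unitary ℂ :=
    fun q => ∏ i with Precedes κ i j, c i j ^ (κ i).val (q i) with hσ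
  set Y : Model κ (vacuumOff Φu A) →L[ℂ] Model κ (vacuumOff Φu A) :=
    scalarDiag _ _ σ * forwardAt κ j with hY
  suffices h : (B.symm : H →L[ℂ] Model κ (vacuumOff Φu A)) ∘L A j ∘L
      (B : Model κ (vacuumOff Φu A) →L[ℂ] H) = Y by
    have h' := congrArg (fun X : Model κ (vacuumOff Φu A) →L[ℂ] Model κ (vacuumOff Φu A) =>
      B (X f)) h
    simpa [hY] using h'
  refine L2.ext_single fun q x => L2.ext_inner_single fun q' y => ?_
  refine Eq.trans ?_ (L2.inner_single_left q' y (Y (lp.single 2 q x))).symm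
  rw [hY, mul_apply_eq_comp, scalarDiag_apply, forwardAt, pull_apply]
  have h1 : inner ℂ (lp.single 2 q' y : Model κ (vacuumOff Φu A))
      (((B.symm : H →L[ℂ] Model κ (vacuumOff Φu A)) ∘L A j ∘L
      (B : Model κ (vacuumOff Φu A) →L[ℂ] H)) (lp.single 2 q x))
      = inner ℂ (B (lp.single 2 q' y)) (A j (B (lp.single 2 q x))) := by
    rw [← B.inner_map_map]
    simp
  have h2 : A j (monomialOff A (l₁ ++ j :: l₂) (exponents κ q) x)
      = (σ q : ℂ) • monomialOff A (l₁ ++ j :: l₂)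
        (Function.update (exponents κ q) j (exponents κ q j + 1)) x := by
    have h := (hA.off Φu).mul_monomial (k := exponents κ q) h₁ h₂
    rw [prod_precedes κ hl hmem hp fun i : {i : Fin n // i ∉ Φu} => c i j ^ exponents κ q i] at h
    exact congrArg (fun X : H →L[ℂ] H => X x) h
  rw [h1, hB, fromModel_single, fromModel_single, h2, inner_smul_right,
    hA.inner_monomialOff hκ hl hmem y.2 x.2, inner_smul_right]
  -- The coefficient is non-zero only if `q'` is `q` raised by one at `j`. Then `σ q' = σ q`, as `j`
  -- does not precede itself.
  by_cases hq : exponents κ q' = Function.update (exponents κ q) j (exponents κ q j + 1)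
  · have hj : (κ j).val (q' j) = (κ j).val (q j) + 1 := by
      simpa [exponents] using congrFun hq j
    have hne : ∀ i, i ≠ j → q' i = q i := fun i hi =>
      (κ i).val_injective (by simpa [exponents, hi] using congrFun hq i)
    have hu : Function.update q' j ((κ j).pred (q' j)) = q := by
      funext i
      by_cases hi : i = j
      · subst hi
        rw [Function.update_self]
        exact (κ i).val_injective (by rw [Kind.val_pred, hj, Nat.add_sub_cancel])
      · rw [Function.update_of_ne hi, hne i hi]
    have hs : σ q' = σ q := Finset.prod_congr rfl fun i hi => by
      rw [hne i]
      rintro rfl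
      have h := (Finset.mem_filter_univ _).mp hi
      exact Precedes.irrefl κ _ h
    rw [if_pos hq, if_pos (by simp [hj]), hu, hs, lp.single_apply_self]
    rfl
  · rw [if_neg hq]
    split_ifs with hj
    · rw [lp.single_apply_ne, inner_zero_right, mul_zero, mul_zero]
      intro hu
      refine hq (funext fun i => ?_)
      have hi' := congrFun hu i
      by_cases hi : i = j
      · subst hi
        rw [Function.update_self] at hi' ⊢
        have h3 : (κ i).val (q' i) ≠ 0 := hj
        have h4 := Kind.val_pred (κ i) (q' i)
        rw [hi'] at h4
        change (κ i).val (q' i) = (κ i).val (q i) + 1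
        omega
      · rw [Function.update_of_ne hi] at hi' ⊢
        simp only [exponents, hi']
    · simp

-- The adjoint of the forward relation. The diagonal factor commutes with `forwardAt κ j`, so it can
-- be kept on the left and is merely conjugated.
open Classical in
theorem fromModel_backward (hp : l.Pairwise (Precedes κ)) (j : {i : Fin n // i ∉ Φu})
    (f : Model κ (vacuumOff Φu A)) :
    star (A j) (fromModel hA hκ hl hmem hirr f) = fromModel hA hκ hl hmem hirr
      (scalarDiag _ _ (fun q => ∏ i with Precedes κ i j, star (c i j) ^ (κ i).val (q i))
        (star (forwardAt κ j) f)) := by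
  set σ : (∀ i, (κ i).Idx) → unitary ℂ :=
    fun q => ∏ i with Precedes κ i j, c i j ^ (κ i).val (q i) with hσ
  set Y : Model κ (vacuumOff Φu A) →L[ℂ] Model κ (vacuumOff Φu A) :=
    scalarDiag _ _ σ * forwardAt κ j with hY
  have hcom : Commute (scalarDiag _ (vacuumOff Φu A) σ) (forwardAt κ j) :=
    commute_scalarDiag_forwardAt κ fun q m => Finset.prod_congr rfl fun i hi => by
      rw [Function.update_of_ne]
      rintro rfl
      have h := (Finset.mem_filter_univ _).mp hi
      exact Precedes.irrefl κ _ h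
  have hs : star σ = fun q => ∏ i with Precedes κ i j, star (c i j) ^ (κ i).val (q i) := by
    funext q
    rw [Pi.star_apply, star_prod]
    exact Finset.prod_congr rfl fun a _ => star_pow _ _
  rw [star_apply_of_intertwines _ (M := Y) (fromModel_forward hA hκ hl hmem hirr hp j), hY,
    hcom.eq, star_mul, star_scalarDiag, hs]
  rfl

/-- A unitary member passes through the whole monomial before it reaches the vacuum, so every factor
contributes a twist. -/
theorem fromModel_unitary {j : Fin n} (hj : j ∈ Φu)
    (T : unitary (vacuumOff Φu A →L[ℂ] vacuumOff Φu A))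
    (hT : ∀ x : vacuumOff Φu A, ((T : vacuumOff Φu A →L[ℂ] vacuumOff Φu A) x : H) = A j x)
    (f : Model κ (vacuumOff Φu A)) :
    A j (fromModel hA hκ hl hmem hirr f) = fromModel hA hκ hl hmem hirr
      (scalarDiag _ _ (fun q => ∏ i : {i : Fin n // i ∉ Φu}, c i j ^ (κ i).val (q i))
        (lastAt κ T f)) := by
  classical
  set B := fromModel hA hκ hl hmem hirr with hB
  set σ : (∀ i, (κ i).Idx) → unitary ℂ :=
    fun q => ∏ i : {i : Fin n // i ∉ Φu}, c i j ^ (κ i).val (q i) with hσ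
  suffices h : A j ∘L (B : Model κ (vacuumOff Φu A) →L[ℂ] H)
      = (B : Model κ (vacuumOff Φu A) →L[ℂ] H) ∘L (scalarDiag _ _ σ * lastAt κ T) from
    congrArg (fun X : Model κ (vacuumOff Φu A) →L[ℂ] H => X f) h
  refine L2.ext_single fun q x => ?_
  have h1 : (scalarDiag _ (vacuumOff Φu A) σ * lastAt κ T) (lp.single 2 q x)
      = (σ q : ℂ) • lp.single (E := fun _ => vacuumOff Φu A) 2 q
        ((T : vacuumOff Φu A →L[ℂ] vacuumOff Φu A) x) := by
    ext1
    funext q'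
    rw [mul_apply_eq_comp, scalarDiag_apply, lastAt, diag_apply]
    by_cases h : q' = q
    · subst h
      simp
    · simp [h]
  have h2 := mul_monomial_of_twist (B := fun a : {i : Fin n // i ∉ Φu} => A a) (l := l)
    (k := exponents κ q) (X := A j) (d := fun a => c a j)
    fun a _ => hA.mul j a fun h => a.2 (h ▸ hj)
  have h3 : (l.map fun a : {i : Fin n // i ∉ Φu} => c a j ^ exponents κ q a).prod = σ q := by
    rw [← List.prod_toFinset _ hl]
    refine Finset.prod_congr ?_ fun _ _ => rfl
    ext a
    simp [hmem]
  rw [h3] at h2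
  change A j (B (lp.single 2 q x)) =
    B ((scalarDiag _ (vacuumOff Φu A) σ * lastAt κ T) (lp.single 2 q x))
  rw [h1, map_smul, hB, fromModel_single, fromModel_single, hT]
  exact congrArg (fun X : H →L[ℂ] H => X x) h2

/-- The unitary members restrict to an irreducible family on the vacuum. -/
theorem isIrreducibleFamily_restrict
    (T : {i : Fin n // i ∈ Φu} → unitary (vacuumOff Φu A →L[ℂ] vacuumOff Φu A))
    (hT : ∀ j (x : vacuumOff Φu A),
      ((T j : vacuumOff Φu A →L[ℂ] vacuumOff Φu A) x : H) = A j x ∧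
        ((star (T j) : vacuumOff Φu A →L[ℂ] vacuumOff Φu A) x : H) = star (A j) x)
    (hA : ScalarTwisted c A) (hκ : ∀ a, HasKind (κ a) (A a)) (hl : l.Nodup)
    (hmem : ∀ a, a ∈ l) (hirr : IsIrreducibleFamily A) :
    IsIrreducibleFamily fun j => (T j : vacuumOff Φu A →L[ℂ] vacuumOff Φu A) := by
  classical
  have := hirr.1
  refine ⟨(Submodule.nontrivial_iff_ne_bot).mpr (vacuumOff_ne_bot hA hκ hl hmem),
    fun M hM hinv => or_iff_not_imp_left.mpr fun hM0 => ?_⟩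
  have : CompleteSpace M := hM.completeSpace_coe
  rw [← Submodule.orthogonal_eq_bot_iff, Submodule.eq_bot_iff]
  intro x hx
  have hd := hA.dense_span_monomial hirr hκ hl hmem (M := M.map (vacuumOff Φu A).subtype)
    (by
      obtain ⟨y, hy, hy0⟩ := Submodule.exists_mem_ne_zero_of_ne_bot hM0
      refine (Submodule.ne_bot_iff _).mpr ⟨y, ⟨y, hy, rfl⟩, fun h => hy0 (Subtype.ext h)⟩)
    (by
      rintro _ ⟨y, -, rfl⟩
      exact y.2)
    (by
      rintro j hj _ ⟨y, hy, rfl⟩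
      exact ⟨⟨_, (hinv ⟨j, hj⟩ y hy).1, (hT ⟨j, hj⟩ y).1⟩,
        ⟨_, (hinv ⟨j, hj⟩ y hy).2, (hT ⟨j, hj⟩ y).2⟩⟩)
  -- A vacuum vector orthogonal to `M` is orthogonal to every monomial applied to `M`: by hypothesis
  -- for exponent zero, and by orthogonality of the monomials otherwise.
  have h0 : (x : H) = 0 := by
    refine hd.eq_zero_of_inner_left ℂ fun w hw => ?_
    rw [SetLike.mem_coe] at hw
    induction hw using Submodule.span_induction with
    | mem w hw =>
      obtain ⟨k, _, ⟨y, hy, rfl⟩, rfl⟩ := hw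
      have h := (hA.off Φu).inner_monomial hκ hl (k := 0) x.2 y.2
        (fun a _ => (κ a).zero_mem_range) k
      rw [monomial_zero] at h
      refine h.trans ?_
      split_ifs
      · exact (Submodule.mem_orthogonal' M x).mp hx y hy
      · rfl
    | zero => simp
    | add a b _ _ ha hb => rw [inner_add_right, ha, hb, add_zero]
    | smul e a _ ha => rw [inner_smul_right, ha, mul_zero]
  exact Subtype.ext h0

end Intertwiner

end

end TwistedPPI

/-! ### Assembly of the model -/

theorem mainTheorem3 {n : ℕ} {H : Type u} [NormedAddCommGroup H] [InnerProductSpace ℂ H]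
    [CompleteSpace H] (U : Fin n → Fin n → unitary (H →L[ℂ] H)) (V : Fin n → H →L[ℂ] H)
    (hV : TwistedPPI.IsTwistedFamily U V) (hirr : TwistedPPI.IsIrreducibleFamily V) :
    -- the set `Φu`, and the partition of its complement into `Φs`, `Φb`, `Φp`, given by the types
    ∃ (Φu : Finset (Fin n)) (κ : {i : Fin n // i ∉ Φu} → TwistedPPI.Kind)
      (Hu : Type u) (_ : NormedAddCommGroup Hu) (_ : InnerProductSpace ℂ Hu)
      (_ : CompleteSpace Hu)
      -- the twisting unitaries and the unitary members of the family, as operators on `Hu`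
      (Uu : Fin n → Fin n → unitary (Hu →L[ℂ] Hu))
      (T : {i : Fin n // i ∈ Φu} → unitary (Hu →L[ℂ] Hu))
      (W : H ≃ₗᵢ[ℂ] TwistedPPI.Model κ Hu),
      TwistedPPI.IsTwistSystem Uu ∧
      (∀ i j, i ≠ j → ∀ x, W ((U i j : H →L[ℂ] H) x) = TwistedPPI.lastAt κ (Uu i j) (W x)) ∧
      TwistedPPI.IsIrreducibleFamily (fun i => (T i : Hu →L[ℂ] Hu)) ∧
      (∀ i j : {i : Fin n // i ∈ Φu}, i ≠ j → star (T i) * T j = Uu i j * T j * star (T i)) ∧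
      (∀ (k : {i : Fin n // i ∈ Φu}) (i j : Fin n), i ≠ j → Commute (T k) (Uu i j)) ∧
      (∀ (j : {i : Fin n // i ∉ Φu}) (x : H),
        W (V j x) = TwistedPPI.modelNonUnitary κ Uu j (W x)) ∧
      (∀ (j : {i : Fin n // i ∈ Φu}) (x : H),
        W (V j x) = TwistedPPI.modelUnitary κ Uu j (T j) (W x)) := by
  classical
  open TwistedPPI in
  obtain ⟨c, hc, hUc⟩ := hV.exists_scalarTwisted hirr
  set Φu : Finset (Fin n) := {i | V i ∈ unitary (H →L[ℂ] H)} with hΦu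
  have hex : ∀ a : {i : Fin n // i ∉ Φu}, ∃ κ : Kind,
      HasKind κ (if κ = .backward then star (V a) else V a) := by
    rintro ⟨a, ha⟩
    have ha' : V a ∉ unitary (H →L[ℂ] H) := fun h => ha ((Finset.mem_filter_univ a).mpr h)
    rcases (hc.unitary_or_hasKind hirr a).resolve_left ha' with ⟨κ, hκ, h⟩ | h
    · exact ⟨κ, by rwa [if_neg hκ]⟩
    · exact ⟨.backward, by rwa [if_pos rfl]⟩
  choose κ hκ using hex
  -- False exactly at the backward shifts, which are the members replaced by their adjoints.
  let ε : Fin n → Bool := fun i => if h : i ∉ Φu then decide (κ ⟨i, h⟩ ≠ .backward) else true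
  have hεa : ∀ a : {i : Fin n // i ∉ Φu}, ε a = decide (κ a ≠ .backward) := fun a =>
    dif_pos a.2
  have hεu : ∀ j ∈ Φu, ε j = true := fun j hj => dif_neg (not_not.mpr hj)
  set A : Fin n → H →L[ℂ] H := fun i => if ε i then V i else star (V i) with hAdef
  set c' : Fin n → Fin n → unitary ℂ := fun i j => if ε i = ε j then c i j else star (c i j)
    with hc'def
  have hA : ScalarTwisted c' A := hc.flip ε
  have hirrA : IsIrreducibleFamily A := hirr.flip ε
  have hAκ : ∀ a : {i : Fin n // i ∉ Φu}, HasKind (κ a) (A a) := by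
    intro a
    have h := hκ a
    by_cases hb : κ a = .backward
    · simpa only [hAdef, hεa, hb, ne_eq, not_true_eq_false, decide_false, Bool.false_eq_true,
        if_false, if_true] using h
    · simpa only [hAdef, hεa, hb, ne_eq, not_false_eq_true, decide_true, if_false, if_true]
        using h
  -- The case distinction in the model, `c a j` or `c j a`, records the conjugations caused by
  -- passing to adjoints at `a` and at `j`.
  have htwist : ∀ (a : {i : Fin n // i ∉ Φu}) (j : Fin n), (a : Fin n) ≠ j →
      twistScalar κ c a j = if ε j then c' a j else star (c' a j) := by
    intro a j haj
    have hs := hc.symm a j haj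
    have ha := hεa a
    simp only [hc'def, ha]
    unfold twistScalar
    cases h : κ a <;> cases ε j <;> simp [hs]
  obtain ⟨l, hl, hmem, hp⟩ := exists_list_precedes κ
  set B := fromModel hA hAκ hl hmem hirrA with hB
  have hAu : ∀ j ∈ Φu, A j = V j := fun j hj => by simp [hAdef, hεu j hj]
  have hres : ∀ j : {i : Fin n // i ∈ Φu},
      ∃ T : unitary (vacuumOff Φu A →L[ℂ] vacuumOff Φu A), ∀ x : vacuumOff Φu A,
        ((T : vacuumOff Φu A →L[ℂ] vacuumOff Φu A) x : H) = A j x ∧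
          ((star T : vacuumOff Φu A →L[ℂ] vacuumOff Φu A) x : H) = star (A j) x := fun j =>
    exists_restrict_unitary (by rw [hAu j j.2]; exact (Finset.mem_filter_univ j.1).mp j.2)
      fun x hx => hA.vacuum_invariant j.2 hx
  choose T hT using hres
  have hcomm : ∀ (S : vacuumOff Φu A →L[ℂ] vacuumOff Φu A) (z : unitary ℂ),
      Commute S (scalarUnitary (vacuumOff Φu A) z : vacuumOff Φu A →L[ℂ] vacuumOff Φu A) :=
    fun S z => (Algebra.commutes (z : ℂ) S).symm
  refine ⟨Φu, κ, vacuumOff Φu A, inferInstance, inferInstance, inferInstance,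
    fun i j => scalarUnitary _ (c i j), T, B.symm, ⟨fun i j h => ?_, fun i j k m _ _ => ?_⟩,
    fun i j h x => ?_, isIrreducibleFamily_restrict T hT hA hAκ hl hmem hirrA,
    fun i j h => ?_, fun k i j _ => ?_, fun j x => ?_, fun j x => ?_⟩
  · rw [hc.symm i j h, map_star]
  · exact Subtype.ext (hcomm _ _)
  · rw [hUc i j h, Algebra.algebraMap_eq_smul_one]
    ext1
    funext q
    rw [lastAt, diag_apply, scalarUnitary_apply]
    simp
  · refine Subtype.ext (ContinuousLinearMap.ext fun x => Subtype.ext ?_)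
    have hij : (i : Fin n) ≠ j := fun h' => h (Subtype.ext h')
    have hcij : c' i j = c i j := by simp [hc'def, hεu i i.2, hεu j j.2]
    have h1 := congrArg (fun X : H →L[ℂ] H => X x) (hA.star_mul i j hij)
    rw [hcij] at h1
    change ((star (T i) : vacuumOff Φu A →L[ℂ] vacuumOff Φu A)
      ((T j : vacuumOff Φu A →L[ℂ] vacuumOff Φu A) x) : H)
      = ((scalarUnitary (vacuumOff Φu A) (c i j) : vacuumOff Φu A →L[ℂ] vacuumOff Φu A)
        ((T j : vacuumOff Φu A →L[ℂ] vacuumOff Φu A)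
          ((star (T i) : vacuumOff Φu A →L[ℂ] vacuumOff Φu A) x)) : vacuumOff Φu A)
    rw [scalarUnitary_apply, Submodule.coe_smul, (hT i _).2, (hT j _).1, (hT j _).1, (hT i _).2]
    exact h1
  · exact Subtype.ext (hcomm _ _)
  · obtain ⟨f, rfl⟩ := B.surjective x
    rw [B.symm_apply_apply, LinearIsometryEquiv.symm_apply_eq, modelNonUnitary,
      twistProd_scalarUnitary]
    have hσ : ∀ (q : ∀ i, (κ i).Idx) (a : {i : Fin n // i ∉ Φu}), Precedes κ a j →
        twistScalar κ c a j ^ (κ a).val (q a)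
          = (if ε j then c' a j else star (c' a j)) ^ (κ a).val (q a) := fun q a ha => by
      rw [htwist a j]
      exact fun h => Precedes.irrefl κ j (Subtype.ext h ▸ ha)
    by_cases hb : κ j = .backward
    · have hj : ε j = false := by simp [hεa, hb]
      have hAj : V j = star (A j) := by simp [hAdef, hj]
      rw [hAj, fromModel_backward hA hAκ hl hmem hirrA hp j, coreAt_of_eq_backward κ hb,
        mul_apply_eq_comp]
      congr 3
      funext q
      refine Finset.prod_congr rfl fun a ha => ?_
      rw [hσ q a ((Finset.mem_filter_univ a).mp ha), hj]
      rfl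
    · have hj : ε j = true := by simp [hεa, hb]
      have hAj : V j = A j := by simp [hAdef, hj]
      rw [hAj, fromModel_forward hA hAκ hl hmem hirrA hp j, coreAt_of_ne_backward κ hb,
        mul_apply_eq_comp]
      congr 3
      funext q
      refine Finset.prod_congr rfl fun a ha => ?_
      rw [hσ q a ((Finset.mem_filter_univ a).mp ha), hj, if_pos rfl]
  · obtain ⟨f, rfl⟩ := B.surjective x
    have hf := fromModel_unitary hA hAκ hl hmem hirrA j.2 (T j) (fun x => (hT j x).1) f
    rw [B.symm_apply_apply, LinearIsometryEquiv.symm_apply_eq, modelUnitary,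
      twistProd_scalarUnitary, ← hAu j j.2, hf, mul_apply_eq_comp]
    congr 3
    funext q
    rw [Finset.filter_true]
    refine Finset.prod_congr rfl fun a _ => ?_
    rw [htwist a j fun h => a.2 (h ▸ j.2), hεu j j.2, if_pos rfl]
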